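/- Let $d\ge 2$, let $\theta$ be a real antisymmetric $d\times d$ matrix, and let $A_\theta$ be the unital $*$-algebra generated by unitaries $U_1,\dots,U_d$ subject to $U_kU_l=e^{2\pi i\theta_{kl}}U_lU_k$; write $U^m=U_1^{m_1}\cdots U_d^{m_d}$ for $m\in\mathbb Z^d$. Let $L_2(\mathbb T^d_\theta)$ be the completion of $A_\theta$ for the inner product in which $(U^m)_{m\in\mathbb Z^d}$ is orthonormal, let $L_\infty(\mathbb T^d_\theta)\subseteq\mathcal B(L_2(\mathbb T^d_\theta))$ be the weak operator closure of $A_\theta$ acting by left multiplication, and let $C^\infty(\mathbb T^d_\theta)\subseteq L_\infty(\mathbb T^d_\theta)$ be the set of all $T$ such that the vector $T(1)\in L_2(\mathbb T^d_\theta)$ lies in the domain of $D_1^{\alpha_1}\cdots D_d^{\alpha_d}$ for every $\alpha\in\mathbb Z_{\ge0}^d$, where $D_jU^m=m_jU^m$. **Multiple operator integrals.** Let $x$ be a bounded self-adjoint operator and let $V_1,\dots,V_n$ be bounded operators on a separable Hilbert space. If $\varphi(\alpha_0,\dots,\alpha_n)=\int_\Omega a_0(\alpha_0,\omega)\cdots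 a_n(\alpha_n,\omega)\,d\omega$ for all $\alpha_0,\dots,\alpha_n\in\mathrm{spec}(x)$, with a finite measure space $\Omega$ and bounded measurable functions $a_j:\mathbb R\times\Omega\to\mathbb C$, put $$T^x_\varphi(V_1,\dots,V_n)=\int_\Omega a_0(x,\omega)V_1a_1(x,\omega)\cdots V_na_n(x,\omega)\,d\omega$$ (a weak integral). For a smooth $f:(0,\infty)\to\mathbb C$ let $f^{[n]}:(0,\infty)^{n+1}\to\mathbb C$ be its divided difference: $f^{[0]}=f$ and $f^{[n]}(\alpha_0,\dots,\alpha_n)=\frac{f^{[n-1]}(\alpha_0,\dots,\alpha_{n-1})-f^{[n-1]}(\alpha_1,\dots,\alpha_n)}{\alpha_0-\alpha_n}$ for distinct $\alpha_0,\dots,\alpha_n$, extended continuously to all of $(0,\infty)^{n+1}$. **Theorem.** Let $x\in C^\infty(\mathbb T^d_\theta)$ be positive and invertible, let $n\ge1$ be an integer, let $b_1,\dots,b_n\in C^\infty(\mathbb T^d_\theta)$, let $k\ge0$ be an even integer with $k\le 2n$, and let $F_{k,d}:(0,\infty)\to\mathbb C$ be any $\frac k2$-th order primitive of $\alpha\mapsto\alpha^{-d/2}$,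 that is, $F_{k,d}^{(k/2)}(\alpha)=\alpha^{-d/2}$ for $\alpha>0$. For $s\in\mathbb R^d\setminus\{0\}$ and $z\in\mathbb C\setminus(-\infty,0)$ put $$S^n_{s,z}(b_1,\dots,b_n)=(-1)^n|s|^{2n}\,\frac1{x|s|^2+z}\,b_1\,\frac1{x|s|^2+z}\,b_2\cdots b_n\,\frac1{x|s|^2+z}.$$ Then $T^x_{F_{k,d}^{[n]}}(b_1,\dots,b_n)$ exists and does not depend on the chosen separation of variables of $F_{k,d}^{[n]}$ on $\mathrm{spec}(x)^{n+1}$, and $$\frac1{2\pi}\int_{\mathbb R^d}\Big(\int_{-\infty}^{\infty}|s|^{-k}S^n_{s,i\lambda}(b_1,\dots,b_n)\,e^{i\lambda}\,d\lambda\Big)ds=(-1)^{\frac k2}\pi^{\frac d2}\,T^x_{F_{k,d}^{[n]}}(b_1,\dots,b_n),$$ where both integrals converge as Bochner integrals in the operator norm; in particular $\int_{-\infty}^\infty=\lim_{N\to\infty}\int_{-N}^N$. -/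

import Mathlib

open MeasureTheory Filter Topology
open scoped InnerProductSpace BoundedContinuousFunction

noncomputable section

namespace NCTorus

/-! ### The noncommutative torus -/

/-- The Hilbert space `L₂(𝕋^d_θ)`, written in the orthonormal basis `(Uⁿ)`, `n ∈ ℤ^d`, of the
completion of `A_θ` for the inner product `⟨a, b⟩ = τ(a* b)`: the vector `f` stands for
`∑ₙ f(n) Uⁿ`. It does not depend on `θ` as a Hilbert space; the left multiplications do. -/
abbrev L2 (d : ℕ) : Type := lp (fun _ : Fin d → ℤ => ℂ) 2

/-- The unit of `A_θ`, seen as the vector `U⁰ = 1` of `L₂(𝕋^d_θ)`. -/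
def one (d : ℕ) : L2 d := lp.single 2 (0 : Fin d → ℤ) (1 : ℂ)

/-- The scalar `c` with `U_k Uⁿ = c U^{n + e_k}`, where `Uⁿ = U_1^{n_1} ⋯ U_d^{n_d}` and
`U_k U_l = e^{2πi θ_{kl}} U_l U_k`: the letter `U_k` is moved past the letters `U_l`, `l < k`. -/
def phase {d : ℕ} (θ : Matrix (Fin d) (Fin d) ℝ) (k : Fin d) (n : Fin d → ℤ) : ℂ :=
  Complex.exp (((2 * Real.pi * ∑ l ∈ Finset.univ.filter (fun l => l < k), θ k l * (n l : ℝ) : ℝ) : ℂ)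
    * Complex.I)

theorem norm_phase {d : ℕ} (θ : Matrix (Fin d) (Fin d) ℝ) (k : Fin d) (n : Fin d → ℤ) :
    ‖phase θ k n‖ = 1 := by
  unfold phase
  exact Complex.norm_exp_ofReal_mul_I _

theorem hasSum_shift {d : ℕ} (θ : Matrix (Fin d) (Fin d) ℝ) (k : Fin d) (f : L2 d) :
    HasSum (fun m : Fin d → ℤ =>
      ‖phase θ k (m - Pi.single k 1) * f (m - Pi.single k 1)‖ ^ (2 : ENNReal).toReal)
      (‖f‖ ^ (2 : ENNReal).toReal) := by
  have h := lp.hasSum_norm (p := 2) (by simp) f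
  have h2 := (Equiv.subRight (Pi.single k 1 : Fin d → ℤ)).hasSum_iff.mpr h
  refine h2.congr_fun ?_ |> fun h3 => h3
  intro m
  simp [norm_phase]

/-- Left multiplication by the generator `U_k` on `L₂(𝕋^d_θ)`: it sends the basis vector `Uⁿ` to
`U_k Uⁿ = phase θ k n • U^{n + e_k}`. -/
def U {d : ℕ} (θ : Matrix (Fin d) (Fin d) ℝ) (k : Fin d) : L2 d →L[ℂ] L2 d :=
  LinearMap.mkContinuous
    { toFun := fun f =>
        ⟨fun m => phase θ k (m - Pi.single k 1) * f (m - Pi.single k 1),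
          memℓp_gen (hasSum_shift θ k f).summable⟩
      map_add' := fun f g => by
        ext m
        exact mul_add _ _ _
      map_smul' := fun c f => by
        ext m
        exact mul_left_comm _ _ _ }
    1 (fun f => by
      refine le_of_eq ?_
      rw [one_mul, lp.norm_eq_tsum_rpow (by simp)]
      refine (congrArg (· ^ (1 / (2 : ENNReal).toReal)) (hasSum_shift θ k f).tsum_eq).trans ?_
      simp only [ENNReal.toReal_ofNat]
      rw [← Real.rpow_mul (norm_nonneg _)]
      norm_num)

/-- The `*`-algebra `A_θ` generated by `U_1, …, U_d`, acting on `L₂(𝕋^d_θ)` by left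
multiplication. -/
def polyAlg {d : ℕ} (θ : Matrix (Fin d) (Fin d) ℝ) : StarSubalgebra ℂ (L2 d →L[ℂ] L2 d) :=
  StarAlgebra.adjoin ℂ (Set.range (U θ))

/-- `L_∞(𝕋^d_θ)`: the closure of `A_θ` in the weak operator topology. -/
def Linfty {d : ℕ} (θ : Matrix (Fin d) (Fin d) ℝ) : Set (L2 d →L[ℂ] L2 d) :=
  {T | (ContinuousLinearMapWOT.ofCLM T : L2 d →WOT[ℂ] L2 d) ∈
    closure ((fun A : L2 d →L[ℂ] L2 d => (ContinuousLinearMapWOT.ofCLM A : L2 d →WOT[ℂ] L2 d)) ''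
      (polyAlg θ : Set (L2 d →L[ℂ] L2 d)))}

/-- The vector `f = ∑ₙ f(n) Uⁿ` lies in the domain of `D^α = D_1^{α_1} ⋯ D_d^{α_d}` for every
`α ∈ ℕ^d`, where `D_k Uⁿ = n_k Uⁿ`. -/
def IsSmoothVector {d : ℕ} (f : L2 d) : Prop :=
  ∀ α : Fin d → ℕ, Memℓp (fun n : Fin d → ℤ => (∏ k, (n k : ℂ) ^ α k) * f n) 2

/-- `C^∞(𝕋^d_θ)` as a set of operators on `L₂(𝕋^d_θ)`. An operator `T ∈ L_∞(𝕋^d_θ)` is identified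
with the vector `T(1)`, from which it is recovered as left multiplication by `T(1)`; it belongs to
`C^∞(𝕋^d_θ) = ⋂_α dom D^α` when this vector is smooth. -/
def Smooth {d : ℕ} (θ : Matrix (Fin d) (Fin d) ℝ) : Set (L2 d →L[ℂ] L2 d) :=
  {T | T ∈ Linfty θ ∧ IsSmoothVector (T (one d))}

end NCTorus

/-! ### Multiple operator integrals -/

namespace MOI

variable {H : Type*} [NormedAddCommGroup H] [InnerProductSpace ℂ H] [CompleteSpace H]

/-- The alternating product `A_0 V_1 A_1 V_2 ⋯ V_n A_n`. -/
def altProd {n : ℕ} (A : Fin (n + 1) → (H →L[ℂ] H)) (V : Fin n → (H →L[ℂ] H)) : H →L[ℂ] H :=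
  A 0 * (List.ofFn fun i : Fin n => V i * A i.succ).prod

/-- `μ` is the spectral measure `⟨u, E(·) u⟩` of the self-adjoint operator `x` at the vector `u`. -/
def IsSpectralMeasure (x : H →L[ℂ] H) (u : H) (μ : Measure ℝ) : Prop :=
  IsFiniteMeasure μ ∧
    ∀ f : ℝ →ᵇ ℝ, ((∫ t, f t ∂μ : ℝ) : ℂ) = ⟪u, cfc (fun t : ℝ => f t) x u⟫_ℂ

/-- `G = g(x)` in the sense of the Borel functional calculus of the self-adjoint operator `x`, for a
bounded measurable function `g`. -/
def IsBorelCalculus (x : H →L[ℂ] H) (g : ℝ → ℂ) (G : H →L[ℂ] H) : Prop :=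
  ∀ u : H, ∃ μ : Measure ℝ, IsSpectralMeasure x u μ ∧ ⟪u, G u⟫_ℂ = ∫ t, g t ∂μ

/-- `T = ∫_Ω a_0(x,ω) V_1 a_1(x,ω) ⋯ V_n a_n(x,ω) dω` (a weak integral) for some finite measure
space `Ω` and some bounded measurable functions `a_0, …, a_n : ℝ × Ω → ℂ` which separate the
variables of the symbol: `φ(α_0, …, α_n) = ∫_Ω a_0(α_0,ω) ⋯ a_n(α_n,ω) dω` on `spec(x)^{n+1}`. -/
def IsMOI {n : ℕ} (x : H →L[ℂ] H) (φ : (Fin (n + 1) → ℝ) → ℂ) (V : Fin n → (H →L[ℂ] H))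
    (T : H →L[ℂ] H) : Prop :=
  ∃ (Ω : Type) (_ : MeasurableSpace Ω) (μ : Measure Ω) (a : Fin (n + 1) → ℝ → Ω → ℂ)
    (A : Fin (n + 1) → Ω → (H →L[ℂ] H)),
    IsFiniteMeasure μ ∧
    (∀ j, Measurable (Function.uncurry (a j))) ∧
    (∃ C : ℝ, ∀ j t ω, ‖a j t ω‖ ≤ C) ∧
    (∀ α : Fin (n + 1) → ℝ, (∀ j, α j ∈ spectrum ℝ x) → φ α = ∫ ω, ∏ j, a j (α j) ω ∂μ) ∧
    (∀ j ω, IsBorelCalculus x (fun t => a j t ω) (A j ω)) ∧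
    ∀ u v : H, Integrable (fun ω => ⟪u, altProd (fun j => A j ω) V v⟫_ℂ) μ ∧
      ⟪u, T v⟫_ℂ = ∫ ω, ⟪u, altProd (fun j => A j ω) V v⟫_ℂ ∂μ

open Classical in
/-- The multiple operator integral `T^x_φ(V_1, …, V_n)` (with value `0` if the symbol `φ` has no
separation of variables on `spec(x)^{n+1}`). -/
def moi {n : ℕ} (x : H →L[ℂ] H) (φ : (Fin (n + 1) → ℝ) → ℂ) (V : Fin n → (H →L[ℂ] H)) :
    H →L[ℂ] H :=
  if h : ∃ T, IsMOI x φ V T then h.choose else 0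

end MOI

/-! ### Divided differences and primitives -/

namespace DivDiff

/-- The recursive difference quotient, meaningful at points with distinct coordinates. -/
def quotient (f : ℝ → ℂ) : (n : ℕ) → (Fin (n + 1) → ℝ) → ℂ
  | 0, α => f (α 0)
  | n + 1, α => (quotient f n (Fin.init α) - quotient f n (Fin.tail α)) /
      ((α 0 - α (Fin.last (n + 1)) : ℝ) : ℂ)

/-- The divided difference `f^{[n]}`: the continuous extension of the recursive difference quotient
from the points with distinct coordinates. -/
def divDiff (f : ℝ → ℂ) (n : ℕ) : (Fin (n + 1) → ℝ) → ℂ :=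
  extendFrom {α : Fin (n + 1) → ℝ | Function.Injective α} (quotient f n)

/-- `F` is an `m`-th order primitive of `g` on `(0, ∞)`. -/
def IsPrimitive (g : ℝ → ℂ) : ℕ → (ℝ → ℂ) → Prop
  | 0, F => ∀ t : ℝ, 0 < t → F t = g t
  | m + 1, F => ∃ G : ℝ → ℂ, IsPrimitive g m G ∧ ∀ t : ℝ, 0 < t → HasDerivAt F (G t) t

end DivDiff

namespace NCTorus

/-- `S^n_{s,z}(b_1, …, b_n) = (-1)^n |s|^{2n} R b_1 R b_2 ⋯ b_n R` with `R = (x|s|² + z)⁻¹`. -/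
def S {d n : ℕ} (x : L2 d →L[ℂ] L2 d) (s : EuclideanSpace ℝ (Fin d)) (z : ℂ)
    (b : Fin n → (L2 d →L[ℂ] L2 d)) : L2 d →L[ℂ] L2 d :=
  ((-1 : ℂ) ^ n * (‖s‖ : ℂ) ^ (2 * n)) •
    MOI.altProd
      (fun _ => Ring.inverse (((‖s‖ : ℂ) ^ 2) • x + z • (1 : L2 d →L[ℂ] L2 d))) b

/-- The integrand `|s|^{-k} S^n_{s,iλ}(b_1, …, b_n) e^{iλ}`. -/
def integrand {d n : ℕ} (x : L2 d →L[ℂ] L2 d) (k : ℕ) (b : Fin n → (L2 d →L[ℂ] L2 d))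
    (s : EuclideanSpace ℝ (Fin d)) (lam : ℝ) : L2 d →L[ℂ] L2 d :=
  (((‖s‖ : ℂ) ^ k)⁻¹ * Complex.exp ((lam : ℂ) * Complex.I)) • S x s ((lam : ℂ) * Complex.I) b

end NCTorus

end

namespace DivDiff

/-! ### Algebra of divided differences -/

/-! Write `k = 2m` and `w = iλ`. With scalars `α_j` in place of `x`, the integral over `λ` of
`(-|s|²)ⁿ e^w ∏ (α_j |s|² + w)⁻¹` is `2π` times the `n`-th divided difference of `t ↦ e^{-|s|² t}`
(`contour_eq_quotient`). Dividing by `(-|s|²)^m` replaces the exponential by an `m`-th primitive,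
and a divided difference of order `n ≥ m` does not see which primitive is taken
(`IsPrimitive.quotient_eq`). Since `∫ e^{-|s|² t} ds = (π/t)^{d/2}`, integration over `s` yields the
divided difference of `F` with its constant (`IsPrimitive.integral_quotient_exp`).

To pass to operators, `ResolventData.isMOI` shows that an absolutely convergent superposition of
resolvent products is the multiple operator integral of the corresponding scalar superposition. On
the imaginary axis the available norm bound, integrated over `λ`, has size `|s|^{-k}`, which is not
integrable over `ℝ^d`. Hence `c > 0` is chosen below the spectrum and the line is moved to `Re w = 1
- c|s|²/2`: the denominators keep positive real part and `e^w` provides Gaussian decay in `s`.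

For fixed `s ≠ 0` the move does not change the operator. Both line integrals are multiple operator
integrals with the same symbol, so they agree by `IsMOI.unique`; no contour deformation for
operators is needed. That uniqueness is proved first for rank one `V_i`, where everything reduces to
integrals of the symbol against products of spectral measures, and then for general `V_i` by strong
approximation with finite rank operators. -/

theorem quotient_congr {f g : ℝ → ℂ} : ∀ {n : ℕ} {α : Fin (n + 1) → ℝ},
    (∀ j, f (α j) = g (α j)) → quotient f n α = quotient g n α
  | 0, _, h => h 0
  | n + 1, α, h => by
    rw [quotient, quotient, quotient_congr (f := f) (g := g) (α := Fin.init α) fun j => h _,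
      quotient_congr (f := f) (g := g) (α := Fin.tail α) fun j => h _]

theorem quotient_add (f g : ℝ → ℂ) : ∀ (n : ℕ) (α : Fin (n + 1) → ℝ),
    quotient (fun t => f t + g t) n α = quotient f n α + quotient g n α
  | 0, _ => rfl
  | n + 1, α => by
    rw [quotient, quotient, quotient, quotient_add f g n, quotient_add f g n]
    ring

theorem quotient_const_mul (c : ℂ) (f : ℝ → ℂ) : ∀ (n : ℕ) (α : Fin (n + 1) → ℝ),
    quotient (fun t => c * f t) n α = c * quotient f n α
  | 0, _ => rfl
  | n + 1, α => by
    rw [quotient, quotient, quotient_const_mul c f n, quotient_const_mul c f n]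
    ring

theorem quotient_zero : ∀ (n : ℕ) (α : Fin (n + 1) → ℝ), quotient (fun _ => 0) n α = 0
  | 0, _ => rfl
  | n + 1, α => by rw [quotient, quotient_zero n, quotient_zero n, sub_zero, zero_div]

theorem quotient_sum {ι : Type*} (s : Finset ι) (f : ι → ℝ → ℂ) (n : ℕ) (α : Fin (n + 1) → ℝ) :
    quotient (fun t => ∑ i ∈ s, f i t) n α = ∑ i ∈ s, quotient (f i) n α := by
  classical
  induction s using Finset.induction_on with
  | empty => simpa using quotient_zero n α
  | insert i s hi ih =>
    simp only [Finset.sum_insert hi]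
    rw [quotient_add, ih]

theorem injective_init {n : ℕ} {α : Fin (n + 1) → ℝ} (h : Function.Injective α) :
    Function.Injective (Fin.init α : Fin n → ℝ) :=
  h.comp (Fin.castSucc_injective n)

theorem injective_tail {n : ℕ} {α : Fin (n + 1) → ℝ} (h : Function.Injective α) :
    Function.Injective (Fin.tail α : Fin n → ℝ) :=
  h.comp (Fin.succ_injective n)

theorem ends_ne {n : ℕ} {α : Fin (n + 2) → ℝ} (h : Function.Injective α) :
    ((α 0 - α (Fin.last (n + 1)) : ℝ) : ℂ) ≠ 0 := by
  rw [Complex.ofReal_ne_zero, sub_ne_zero]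
  exact fun e => (Fin.last_pos (n := n)).ne (h e)

/-- The Leibniz rule for the product with the coordinate function. -/
theorem quotient_id_mul (f : ℝ → ℂ) : ∀ (n : ℕ) (α : Fin (n + 2) → ℝ), Function.Injective α →
    quotient (fun t => (t : ℂ) * f t) (n + 1) α =
      α 0 * quotient f (n + 1) α + quotient f n (Fin.tail α)
  | 0, α, h => by
    have := ends_ne h
    simp only [quotient, Fin.init, Fin.tail] at *
    field_simp
    simp
    ring
  | n + 1, α, h => by
    have h1 := ends_ne h
    have h2 := ends_ne (injective_tail h)
    rw [quotient, quotient_id_mul f n _ (injective_init h), quotient_id_mul f n _ (injective_tail h),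
      quotient.eq_2 f (n + 1)]
    -- The induction hypothesis on the tail carries the factor `α 1` instead of `α 0`; the recursion
    -- on the tail, cleared of its denominator, accounts for the discrepancy.
    have h3 : quotient f (n + 1) (Fin.tail α) = _ := quotient.eq_2 f n (Fin.tail α)
    rw [eq_div_iff h2] at h3
    have e1 : Fin.tail (Fin.init α) = Fin.init (Fin.tail α) := Fin.tail_init_eq_init_tail α
    rw [e1]
    have e2 : (Fin.init α : Fin (n + 2) → ℝ) 0 = α 0 := rfl
    have e3 : (Fin.tail α : Fin (n + 2) → ℝ) (Fin.last (n + 1)) = α (Fin.last (n + 2)) := rfl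
    rw [e3] at h3
    rw [e2]
    field_simp
    push_cast at h3 ⊢
    linear_combination -h3

/-- By the Leibniz rule, each extra factor `t` raises by at most one the order from which divided
differences vanish. -/
theorem quotient_pow_eq_zero : ∀ (j n : ℕ) (α : Fin (n + 1) → ℝ), Function.Injective α → j < n →
    quotient (fun t => (t : ℂ) ^ j) n α = 0
  | _, 0, _, _, hj => absurd hj (Nat.not_lt_zero _)
  | 0, n + 1, α, h, _ => by
    have key : ∀ (n : ℕ) (α : Fin (n + 2) → ℝ), quotient (fun t => (t : ℂ) ^ 0) (n + 1) α = 0 := by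
      intro n
      induction n with
      | zero => intro α; simp [quotient]
      | succ n ih => intro α; rw [quotient, ih, ih, sub_zero, zero_div]
    exact key n α
  | j + 1, n + 1, α, h, hj => by
    simp only [pow_succ']
    rw [quotient_id_mul _ _ _ h, quotient_pow_eq_zero j (n + 1) α h (by omega),
      quotient_pow_eq_zero j n _ (injective_tail h) (by omega)]
    ring

/-! ### Primitives -/

theorem IsPrimitive.sub_const_mul {g₁ g₂ : ℝ → ℂ} (c : ℂ) : ∀ {m : ℕ} {F₁ F₂ : ℝ → ℂ},
    IsPrimitive g₁ m F₁ → IsPrimitive g₂ m F₂ →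
      IsPrimitive (fun t => g₁ t - c * g₂ t) m (fun t => F₁ t - c * F₂ t)
  | 0, _, _, h₁, h₂ => fun t ht => by simp only [h₁ t ht, h₂ t ht]
  | _ + 1, _, _, ⟨G₁, h₁, d₁⟩, ⟨G₂, h₂, d₂⟩ =>
    ⟨_, h₁.sub_const_mul c h₂, fun t ht => (d₁ t ht).sub ((d₂ t ht).const_mul c)⟩

theorem IsPrimitive.congr {g₁ g₂ : ℝ → ℂ} (h : ∀ t, 0 < t → g₁ t = g₂ t) : ∀ {m : ℕ} {F : ℝ → ℂ},
    IsPrimitive g₁ m F → IsPrimitive g₂ m F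
  | 0, _, h₁ => fun t ht => (h₁ t ht).trans (h t ht)
  | _ + 1, _, ⟨G, h₁, d⟩ => ⟨G, h₁.congr h, d⟩

/-- A function on `(0, ∞)` whose `m`-th derivative vanishes is a polynomial of degree `< m`. -/
theorem IsPrimitive.exists_coeff : ∀ {m : ℕ} {P : ℝ → ℂ}, IsPrimitive (fun _ => 0) m P →
    ∃ c : ℕ → ℂ, ∀ t, 0 < t → P t = ∑ j ∈ Finset.range m, c j * (t : ℂ) ^ j
  | 0, P, h => ⟨0, fun t ht => by simpa using h t ht⟩
  | m + 1, P, ⟨G, hG, hd⟩ => by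
    obtain ⟨c, hc⟩ := hG.exists_coeff
    let Q : ℝ → ℂ := fun t => ∑ j ∈ Finset.range m, c j * ((t : ℂ) ^ (j + 1) / ((j : ℂ) + 1))
    have hQ : ∀ t : ℝ, 0 < t → HasDerivAt Q (G t) t := by
      intro t ht
      rw [hc t ht]
      refine HasDerivAt.fun_sum fun j _ => HasDerivAt.const_mul _ ?_
      have h1 := ((hasDerivAt_id (t : ℂ)).pow (j + 1)).comp_ofReal.div_const ((j : ℂ) + 1)
      have h2 : (j : ℂ) + 1 ≠ 0 := Nat.cast_add_one_ne_zero j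
      refine h1.congr_deriv ?_
      simp only [id, Nat.add_sub_cancel, mul_one]
      push_cast
      field_simp
    have hconst : ∀ t : ℝ, 0 < t → P t - Q t = P 1 - Q 1 := by
      intro t ht
      refine (convex_Ioi (0 : ℝ)).is_const_of_fderivWithin_eq_zero (𝕜 := ℝ)
        (f := fun t => P t - Q t) ?_ ?_ ht (Set.mem_Ioi.2 one_pos)
      · exact fun s hs => ((hd s hs).sub (hQ s hs)).differentiableAt.differentiableWithinAt
      · intro s hs
        have h3 : HasDerivAt (fun t => P t - Q t) 0 s := by
          have h4 := (hd s hs).sub (hQ s hs)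
          rwa [sub_self] at h4
        rw [h3.hasFDerivAt.hasFDerivWithinAt.fderivWithin (isOpen_Ioi.uniqueDiffWithinAt hs)]
        ext; simp
    refine ⟨fun j => if j = 0 then P 1 - Q 1 else c (j - 1) / (((j - 1 : ℕ) : ℂ) + 1), fun t ht => ?_⟩
    rw [Finset.sum_range_succ']
    have := hconst t ht
    simp only [Nat.add_eq_zero_iff, one_ne_zero, and_false, if_false, Nat.add_sub_cancel, if_true,
      pow_zero, mul_one]
    rw [← this, eq_comm, add_comm, sub_add_eq_add_sub, sub_eq_iff_eq_add]
    congr 1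
    exact Finset.sum_congr rfl fun j _ => by ring

theorem IsPrimitive.quotient_eq_zero {m n : ℕ} {P : ℝ → ℂ} (h : IsPrimitive (fun _ => 0) m P)
    (hmn : m ≤ n) {α : Fin (n + 1) → ℝ} (hα : Function.Injective α) (hpos : ∀ j, 0 < α j) :
    quotient P n α = 0 := by
  obtain ⟨c, hc⟩ := h.exists_coeff
  rw [quotient_congr (g := fun t => ∑ j ∈ Finset.range m, c j * (t : ℂ) ^ j)
    fun j => hc _ (hpos j), quotient_sum]
  refine Finset.sum_eq_zero fun j hj => ?_
  rw [quotient_const_mul, quotient_pow_eq_zero j n α hα (by have := Finset.mem_range.1 hj; omega),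
    mul_zero]

/-- Divided differences of order `n ≥ m` only depend on the `m`-th derivative. -/
theorem IsPrimitive.quotient_eq {g₁ g₂ : ℝ → ℂ} {m n : ℕ} {F₁ F₂ : ℝ → ℂ} {c : ℂ}
    (h₁ : IsPrimitive g₁ m F₁) (h₂ : IsPrimitive g₂ m F₂) (hg : ∀ t, 0 < t → g₁ t = c * g₂ t)
    (hmn : m ≤ n) {α : Fin (n + 1) → ℝ} (hα : Function.Injective α) (hpos : ∀ j, 0 < α j) :
    quotient F₁ n α = c * quotient F₂ n α := by
  have h := ((h₁.sub_const_mul c h₂).congr (g₂ := fun _ => 0)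
    fun t ht => by rw [hg t ht, sub_self]).quotient_eq_zero hmn hα hpos
  have h3 := quotient_add F₁ (fun t => (-c) * F₂ t) n α
  rw [quotient_const_mul] at h3
  have h4 : (fun t => F₁ t - c * F₂ t) = fun t => F₁ t + (-c) * F₂ t := by
    funext t; ring
  rw [h4, h3] at h
  linear_combination h

theorem integral_quotient {Ω : Type*} [MeasurableSpace Ω] {μ : Measure Ω} {f : Ω → ℝ → ℂ} :
    ∀ {n : ℕ} {α : Fin (n + 1) → ℝ}, (∀ j, Integrable (fun ω => f ω (α j)) μ) →
      Integrable (fun ω => quotient (f ω) n α) μ ∧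
        ∫ ω, quotient (f ω) n α ∂μ = quotient (fun t => ∫ ω, f ω t ∂μ) n α
  | 0, _, h => ⟨h 0, rfl⟩
  | n + 1, α, h => by
    have h1 := integral_quotient (f := f) (μ := μ) (α := Fin.init α) fun j => h _
    have h2 := integral_quotient (f := f) (μ := μ) (α := Fin.tail α) fun j => h _
    simp only [quotient]
    exact ⟨(h1.1.sub h2.1).div_const _, by
      rw [integral_div, integral_sub h1.1 h2.1, h1.2, h2.2]⟩

end DivDiff

namespace DivDiff

/-! ### Iterated primitives of exponentials and of negative powers -/

/-- The `m`-th primitive of `t ↦ e^{-rt}` with all iterated primitives vanishing at `t = 1`. -/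
noncomputable def expPrimitive : ℕ → ℝ → ℝ → ℂ
  | 0, r, t => Complex.exp (-(r * t : ℝ))
  | m + 1, r, t => ∫ u in (1 : ℝ)..t, expPrimitive m r u

theorem continuous_expPrimitive : ∀ m : ℕ, Continuous (Function.uncurry (expPrimitive m))
  | 0 => by
    simp only [Function.uncurry_def, expPrimitive]
    fun_prop
  | m + 1 => by
    have h := continuous_expPrimitive m
    simp only [Function.uncurry_def, expPrimitive]
    refine intervalIntegral.continuous_parametric_intervalIntegral_of_continuous
      (f := fun p : ℝ × ℝ => expPrimitive m p.1) ?_ continuous_snd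
    exact h.comp (by fun_prop : Continuous fun q : (ℝ × ℝ) × ℝ => (q.1.1, q.2))

theorem hasDerivAt_expPrimitive (m : ℕ) (r t : ℝ) :
    HasDerivAt (expPrimitive (m + 1) r) (expPrimitive m r t) t := by
  have h : Continuous (expPrimitive m r) := (continuous_expPrimitive m).comp (by fun_prop :
    Continuous fun t : ℝ => (r, t))
  exact intervalIntegral.integral_hasDerivAt_right (h.intervalIntegrable _ _)
    h.aestronglyMeasurable.stronglyMeasurableAtFilter h.continuousAt

theorem isPrimitive_expPrimitive (r : ℝ) : ∀ m : ℕ,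
    IsPrimitive (fun t => Complex.exp (-(r * t : ℝ))) m (expPrimitive m r)
  | 0 => fun _ _ => rfl
  | m + 1 => ⟨_, isPrimitive_expPrimitive r m, fun t _ => hasDerivAt_expPrimitive m r t⟩

theorem isPrimitive_exp {r : ℝ} (hr : r ≠ 0) : ∀ m : ℕ,
    IsPrimitive (fun t => Complex.exp (-(r * t : ℝ))) m
      (fun t => ((-r : ℂ) ^ m)⁻¹ * Complex.exp (-(r * t : ℝ)))
  | 0 => fun t _ => by simp
  | m + 1 => ⟨_, isPrimitive_exp hr m, fun t _ => by
    have h0 : (r : ℂ) ≠ 0 := Complex.ofReal_ne_zero.2 hr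
    have h1 : HasDerivAt (fun t : ℝ => (-(r * t : ℝ) : ℂ)) (-r : ℂ) t := by
      refine ((hasDerivAt_id t).const_mul r).ofReal_comp.neg.congr_deriv ?_
      rw [mul_one]
    refine (h1.cexp.const_mul _).congr_deriv ?_
    rw [pow_succ]
    field_simp⟩

/-- The explicit primitive `(-r)^{-m} e^{-rt}` blows up at `r = 0` and need not be integrable in `s`
for `r = |s|²`; the one based at `t = 1` is. They differ by a polynomial of degree `< m`, which the
divided difference kills. -/
theorem quotient_expPrimitive {r : ℝ} (hr : r ≠ 0) {m n : ℕ} (hmn : m ≤ n) {α : Fin (n + 1) → ℝ}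
    (hα : Function.Injective α) (hpos : ∀ j, 0 < α j) :
    quotient (expPrimitive m r) n α =
      ((-r : ℂ) ^ m)⁻¹ * quotient (fun t => Complex.exp (-(r * t : ℝ))) n α := by
  rw [← quotient_const_mul, (isPrimitive_expPrimitive r m).quotient_eq (c := 1)
    (isPrimitive_exp hr m) (fun t _ => (one_mul _).symm) hmn hα hpos, one_mul]

/-- Between `1` and `t` the exponential is at most its value at `min t 1`, so repeated integration
keeps the Gaussian decay in `s` when `r = |s|²`. -/
theorem norm_expPrimitive_le {r : ℝ} (hr : 0 ≤ r) : ∀ (m : ℕ) (t : ℝ),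
    ‖expPrimitive m r t‖ ≤ |t - 1| ^ m * Real.exp (-(r * min t 1))
  | 0, t => by
    rw [expPrimitive, Complex.norm_exp, pow_zero, one_mul, Real.exp_le_exp, Complex.neg_re,
      Complex.ofReal_re, neg_le_neg_iff]
    exact mul_le_mul_of_nonneg_left (min_le_left _ _) hr
  | m + 1, t => by
    rw [expPrimitive, pow_succ, mul_assoc, mul_comm |t - 1|, ← mul_assoc]
    refine intervalIntegral.norm_integral_le_of_norm_le_const fun u hu => ?_
    have hu' : u ∈ Set.uIcc 1 t := Set.uIoc_subset_uIcc hu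
    refine (norm_expPrimitive_le hr m u).trans ?_
    have h1 : |u - 1| ≤ |t - 1| := by
      rcases le_total 1 t with h | h
      · rw [Set.uIcc_of_le h] at hu'
        rw [abs_of_nonneg (by linarith [hu'.1]), abs_of_nonneg (by linarith)]
        linarith [hu'.2]
      · rw [Set.uIcc_of_ge h] at hu'
        rw [abs_of_nonpos (by linarith [hu'.2]), abs_of_nonpos (by linarith)]
        linarith [hu'.1]
    have h2 : min t 1 ≤ min u 1 := by
      rcases le_total 1 t with h | h
      · rw [Set.uIcc_of_le h] at hu'
        rw [min_eq_right h, min_eq_right hu'.1]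
      · rw [Set.uIcc_of_ge h] at hu'
        rw [min_eq_left h, min_eq_left hu'.2]
        exact hu'.1
    gcongr

/-! ### Gaussian superpositions over a Euclidean space -/

section Gaussian

variable {E : Type*} [NormedAddCommGroup E] [InnerProductSpace ℝ E] [FiniteDimensional ℝ E]
  [MeasurableSpace E] [BorelSpace E]

/-- A non-integrable function has Bochner integral `0` by convention, whereas the known value is
positive. -/
theorem integrable_exp_neg_mul_norm_sq {b : ℝ} (hb : 0 < b) :
    Integrable fun s : E => Real.exp (-(‖s‖ ^ 2 * b)) := by
  have h := GaussianFourier.integral_rexp_neg_mul_sq_norm (V := E) hb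
  by_contra hcon
  have h2 : Integrable fun s : E => Real.exp (-b * ‖s‖ ^ 2) := by
    refine Integrable.of_integral_ne_zero ?_
    rw [h]
    positivity
  refine hcon (h2.congr (ae_of_all _ fun s => ?_))
  simp only
  ring_nf

theorem integrable_norm_pow_mul_exp {b : ℝ} (hb : 0 < b) (p : ℕ) :
    Integrable fun s : E => ‖s‖ ^ p * Real.exp (-(‖s‖ ^ 2 * b)) := by
  have key : ∀ y : ℝ, 0 ≤ y → y ^ p * Real.exp (-(y ^ 2 * b)) ≤
      ((p.factorial : ℝ) * Real.exp ((2 * b)⁻¹)) * Real.exp (-(y ^ 2 * (b / 2))) := by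
    intro y hy
    have h1 : y ^ p ≤ p.factorial * Real.exp y := by
      have := Real.pow_div_factorial_le_exp y hy p
      rwa [div_le_iff₀' (by positivity)] at this
    calc y ^ p * Real.exp (-(y ^ 2 * b))
        ≤ (p.factorial * Real.exp y) * Real.exp (-(y ^ 2 * b)) := by gcongr
      _ = p.factorial * Real.exp (y - y ^ 2 * b) := by rw [mul_assoc, ← Real.exp_add]; rfl
      _ ≤ p.factorial * Real.exp ((2 * b)⁻¹ + -(y ^ 2 * (b / 2))) := by
        gcongr
        -- Completing the square absorbs the linear exponent `y` into half of the Gaussian.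
        have h2 : (2 * b)⁻¹ - y + y ^ 2 * (b / 2) = (b / 2) * (y - b⁻¹) ^ 2 := by
          field_simp
          ring
        have h3 : 0 ≤ (b / 2) * (y - b⁻¹) ^ 2 := by positivity
        linarith
      _ = _ := by rw [Real.exp_add, mul_assoc]
  refine ((integrable_exp_neg_mul_norm_sq (E := E) (half_pos hb)).const_mul
    ((p.factorial : ℝ) * Real.exp ((2 * b)⁻¹))).mono'
    (by fun_prop) (ae_of_all _ fun s => ?_)
  rw [Real.norm_of_nonneg (by positivity)]
  exact key _ (norm_nonneg s)

variable (E) in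
/-- The superposition `∫_E expPrimitive m |s|² t ds`: an `m`-th primitive of `(π / t)^{dim E / 2}`. -/
noncomputable def gaussPrimitive (m : ℕ) (t : ℝ) : ℂ := ∫ s : E, expPrimitive m (‖s‖ ^ 2) t

theorem continuous_expPrimitive_norm {E : Type*} [SeminormedAddCommGroup E] (m : ℕ) (t : ℝ) :
    Continuous fun s : E => expPrimitive m (‖s‖ ^ 2) t :=
  (continuous_expPrimitive m).comp (by fun_prop : Continuous fun s : E => (‖s‖ ^ 2, t))

theorem integrable_expPrimitive (m : ℕ) {t : ℝ} (ht : 0 < t) :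
    Integrable fun s : E => expPrimitive m (‖s‖ ^ 2) t :=
  ((integrable_exp_neg_mul_norm_sq (lt_min ht one_pos)).const_mul (|t - 1| ^ m)).mono'
    (continuous_expPrimitive_norm m t).aestronglyMeasurable
    (ae_of_all _ fun _ => norm_expPrimitive_le (sq_nonneg _) m t)

theorem hasDerivAt_gaussPrimitive (m : ℕ) {t : ℝ} (ht : 0 < t) :
    HasDerivAt (gaussPrimitive E (m + 1)) (gaussPrimitive E m t) t := by
  refine (hasDerivAt_integral_of_dominated_loc_of_deriv_le (μ := (volume : Measure E))
    (F := fun t (s : E) => expPrimitive (m + 1) (‖s‖ ^ 2) t)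
    (F' := fun t (s : E) => expPrimitive m (‖s‖ ^ 2) t)
    (bound := fun s => (t + 1) ^ m * Real.exp (-(‖s‖ ^ 2 * min (t / 2) 1)))
    -- This neighbourhood of `t` stays away from `0`, so one Gaussian dominates all the derivatives
    -- on it.
    (s := Set.Ioo (t / 2) (t + 1)) (Ioo_mem_nhds (by linarith) (by linarith))
    (Eventually.of_forall fun t => (continuous_expPrimitive_norm _ t).aestronglyMeasurable)
    (integrable_expPrimitive _ ht) (continuous_expPrimitive_norm _ t).aestronglyMeasurable
    (ae_of_all _ fun s u hu => ?_)
    ((integrable_exp_neg_mul_norm_sq (lt_min (half_pos ht) one_pos)).const_mul _)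
    (ae_of_all _ fun s u _ => hasDerivAt_expPrimitive m _ u)).2
  refine (norm_expPrimitive_le (sq_nonneg _) m u).trans ?_
  have h1 : |u - 1| ≤ t + 1 := by
    rw [abs_le]
    constructor <;> linarith [hu.1, hu.2]
  have h2 := hu.1.le
  gcongr

theorem gaussPrimitive_zero {t : ℝ} (ht : 0 < t) :
    gaussPrimitive E 0 t = (((Real.pi / t) ^ ((Module.finrank ℝ E : ℝ) / 2) : ℝ) : ℂ) := by
  rw [← GaussianFourier.integral_rexp_neg_mul_sq_norm (V := E) ht, ← integral_complex_ofReal]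
  refine integral_congr_ae (ae_of_all _ fun s => ?_)
  simp only [expPrimitive]
  push_cast
  ring_nf

theorem isPrimitive_gaussPrimitive : ∀ m : ℕ,
    IsPrimitive (gaussPrimitive E 0) m (gaussPrimitive E m)
  | 0 => fun _ _ => rfl
  | m + 1 => ⟨_, isPrimitive_gaussPrimitive m, fun _ ht => hasDerivAt_gaussPrimitive m ht⟩

/-- The divided differences of `m`-th primitives of `t ↦ t^{-dim E / 2}` as Gaussian superpositions
of divided differences of exponentials. -/
theorem IsPrimitive.integral_quotient_exp [Nontrivial E] {m n : ℕ} (hmn : m ≤ n) {F : ℝ → ℂ}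
    (hF : IsPrimitive (fun t : ℝ => ((t ^ (-(Module.finrank ℝ E : ℝ) / 2) : ℝ) : ℂ)) m F)
    {α : Fin (n + 1) → ℝ} (hα : Function.Injective α) (hpos : ∀ j, 0 < α j) :
    ∫ s : E, ((-(‖s‖ ^ 2 : ℝ) : ℂ) ^ m)⁻¹ *
        quotient (fun t => Complex.exp (-(‖s‖ ^ 2 * t : ℝ))) n α =
      ((Real.pi ^ ((Module.finrank ℝ E : ℝ) / 2) : ℝ) : ℂ) * quotient F n α := by
  rw [← (isPrimitive_gaussPrimitive (E := E) m).quotient_eq hF (fun t ht => ?_) hmn hα hpos]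
  · have h := (integral_quotient (μ := (volume : Measure E))
      (f := fun s => expPrimitive m (‖s‖ ^ 2)) fun j =>
        integrable_expPrimitive m (hpos j)).2
    refine Eq.trans (integral_congr_ae ?_) h
    filter_upwards [Measure.ae_ne volume (0 : E)] with s hs
    rw [quotient_expPrimitive (by simpa using hs) hmn hα hpos]
  · rw [gaussPrimitive_zero ht, Real.div_rpow Real.pi_pos.le ht.le, neg_div, Real.rpow_neg ht.le,
      div_eq_mul_inv, Complex.ofReal_mul]

end Gaussian

end DivDiff

namespace DivDiff

/-! ### Exponentials as contour integrals of resolvents -/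

theorem ofReal_add_mul_I_ne_zero {a : ℝ} (ha : 0 < a) (t : ℝ) : (a + t * Complex.I : ℂ) ≠ 0 := by
  intro h
  have := congrArg Complex.re h
  simp at this
  exact ha.ne' this

/-- With `n ≥ 1` there are at least two resolvent factors, hence decay of order `t⁻²`. -/
theorem integrable_inv_norm_pow {a : ℝ} (ha : 0 < a) {n : ℕ} (hn : 1 ≤ n) :
    Integrable fun t : ℝ => (‖(a + t * Complex.I : ℂ)‖ ^ (n + 1))⁻¹ := by
  have key : ∀ t : ℝ, (‖(a + t * Complex.I : ℂ)‖ ^ (n + 1))⁻¹ ≤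
      ((min a 1) ^ (n + 1))⁻¹ * (1 + t ^ 2)⁻¹ := by
    intro t
    have hm : 0 < min a 1 := lt_min ha one_pos
    rw [← mul_inv]
    refine inv_anti₀ (by positivity) ?_
    have h1 : (min a 1) ^ 2 * (1 + t ^ 2) ≤ ‖(a + t * Complex.I : ℂ)‖ ^ 2 := by
      rw [← Complex.normSq_eq_norm_sq, Complex.normSq_add_mul_I, mul_add, mul_one]
      refine add_le_add (pow_le_pow_left₀ hm.le (min_le_left _ _) 2) ?_
      exact mul_le_of_le_one_left (sq_nonneg t) (pow_le_one₀ hm.le (min_le_right _ _))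
    have h2 : min a 1 ≤ ‖(a + t * Complex.I : ℂ)‖ := by
      refine (min_le_left _ _).trans ((le_abs_self a).trans ?_)
      simpa using Complex.abs_re_le_norm (a + t * Complex.I : ℂ)
    obtain ⟨l, rfl⟩ := Nat.exists_eq_add_of_le' hn
    calc (min a 1) ^ (l + 1 + 1) * (1 + t ^ 2) = (min a 1) ^ l * ((min a 1) ^ 2 * (1 + t ^ 2)) := by
          ring
      _ ≤ ‖(a + t * Complex.I : ℂ)‖ ^ l * ‖(a + t * Complex.I : ℂ)‖ ^ 2 := by gcongr
      _ = _ := by ring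
  refine (integrable_inv_one_add_sq.const_mul (((min a 1) ^ (n + 1))⁻¹)).mono' ?_ (ae_of_all _ fun t => ?_)
  · refine Continuous.aestronglyMeasurable (Continuous.inv₀ (by fun_prop) fun t => ?_)
    have := norm_ne_zero_iff.2 (ofReal_add_mul_I_ne_zero ha t)
    positivity
  · rw [Real.norm_of_nonneg (by positivity)]
    exact key t

theorem integrable_resolvent_prod {n : ℕ} (hn : 1 ≤ n) {a : Fin (n + 1) → ℝ} (ha : ∀ j, 0 < a j)
    (δ : ℂ) :
    Integrable fun t : ℝ => Complex.exp (δ + t * Complex.I) * ∏ j, (a j + t * Complex.I : ℂ)⁻¹ := by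
  obtain ⟨j₀, hj₀⟩ := Finite.exists_min a
  refine ((integrable_inv_norm_pow (ha j₀) hn).const_mul (Real.exp δ.re)).mono' ?_
    (ae_of_all _ fun t => ?_)
  · refine Continuous.aestronglyMeasurable (Continuous.mul (by fun_prop) ?_)
    exact continuous_finsetProd _ fun j _ => Continuous.inv₀ (by fun_prop) fun t =>
      ofReal_add_mul_I_ne_zero (ha j) t
  · rw [norm_mul, Complex.norm_exp, norm_prod]
    have h1 : (δ + t * Complex.I).re = δ.re := by simp
    rw [h1]
    refine mul_le_mul_of_nonneg_left ?_ (Real.exp_nonneg _)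
    rw [← inv_pow]
    refine (Finset.prod_le_prod (g := fun _ => ‖(a j₀ + t * Complex.I : ℂ)‖⁻¹)
      (fun j _ => norm_nonneg _) fun j _ => ?_).trans (by simp)
    rw [norm_inv]
    refine inv_anti₀ (norm_pos_iff.2 (ofReal_add_mul_I_ne_zero (ha j₀) t)) ?_
    refine le_of_sq_le_sq ?_ (norm_nonneg _)
    rw [← Complex.normSq_eq_norm_sq, Complex.normSq_add_mul_I, ← Complex.normSq_eq_norm_sq,
      Complex.normSq_add_mul_I]
    have := ha j₀
    gcongr
    exact hj₀ j

/-- The difference of the causal exponentials `e^{-at}` and `e^{-bt}`, `t ≥ 0`. -/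
noncomputable def causalDiff (a b t : ℝ) : ℂ :=
  Complex.exp (-(a : ℂ) * (max t 0 : ℝ)) - Complex.exp (-(b : ℂ) * (max t 0 : ℝ))

theorem integrableOn_exp_neg {z : ℂ} (hz : 0 < z.re) :
    IntegrableOn (fun t : ℝ => Complex.exp (-z * t)) (Set.Ioi 0) := by
  simpa using integrableOn_exp_mul_complex_Ioi (a := -z) (by simpa using hz) 0

theorem causalDiff_eq_indicator (a b : ℝ) : causalDiff a b = (Set.Ioi (0 : ℝ)).indicator
    fun t => Complex.exp (-(a : ℂ) * t) - Complex.exp (-(b : ℂ) * t) := by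
  funext t
  rcases le_or_gt t 0 with h | h
  · rw [Set.indicator_of_notMem (by simpa using h)]
    simp [causalDiff, max_eq_right h]
  · rw [Set.indicator_of_mem (Set.mem_Ioi.2 h)]
    simp [causalDiff, max_eq_left h.le]

theorem integrable_causalDiff {a b : ℝ} (ha : 0 < a) (hb : 0 < b) :
    Integrable (causalDiff a b) := by
  rw [causalDiff_eq_indicator, integrable_indicator_iff measurableSet_Ioi]
  exact (integrableOn_exp_neg (by simpa using ha)).sub (integrableOn_exp_neg (by simpa using hb))

theorem fourier_causalDiff {a b : ℝ} (ha : 0 < a) (hb : 0 < b) (ξ : ℝ) :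
    FourierTransform.fourier (causalDiff a b) ξ =
      (b - a) * ((a + (2 * Real.pi * ξ : ℝ) * Complex.I : ℂ)⁻¹ *
        (b + (2 * Real.pi * ξ : ℝ) * Complex.I : ℂ)⁻¹) := by
  have key : ∀ c : ℝ, 0 < c → ∫ t in Set.Ioi (0 : ℝ),
      Complex.exp (-(c + (2 * Real.pi * ξ : ℝ) * Complex.I : ℂ) * t) =
        (c + (2 * Real.pi * ξ : ℝ) * Complex.I : ℂ)⁻¹ := by
    intro c hc
    rw [integral_exp_mul_complex_Ioi (by simpa using hc)]
    simp only [Complex.ofReal_zero, mul_zero, Complex.exp_zero]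
    rw [neg_div_neg_eq, one_div]
  have hint : ∀ c : ℝ, 0 < c → IntegrableOn (fun t : ℝ =>
      Complex.exp (-(c + (2 * Real.pi * ξ : ℝ) * Complex.I : ℂ) * t)) (Set.Ioi 0) :=
    fun c hc => integrableOn_exp_neg (by simpa using hc)
  have h1 := ofReal_add_mul_I_ne_zero ha (2 * Real.pi * ξ)
  have h2 := ofReal_add_mul_I_ne_zero hb (2 * Real.pi * ξ)
  rw [Real.fourier_eq']
  have h3 : ∀ t : ℝ, Complex.exp ((-2 * Real.pi * inner ℝ t ξ : ℝ) * Complex.I) • causalDiff a b t =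
      (Set.Ioi (0 : ℝ)).indicator (fun t : ℝ =>
        Complex.exp (-(a + (2 * Real.pi * ξ : ℝ) * Complex.I : ℂ) * t) -
          Complex.exp (-(b + (2 * Real.pi * ξ : ℝ) * Complex.I : ℂ) * t)) t := by
    intro t
    rw [causalDiff_eq_indicator]
    by_cases ht : t ∈ Set.Ioi (0 : ℝ)
    · rw [Set.indicator_of_mem ht, Set.indicator_of_mem ht, smul_eq_mul, mul_sub, ← Complex.exp_add,
        ← Complex.exp_add]
      congr 2 <;>
      · simp
        ring
    · rw [Set.indicator_of_notMem ht, Set.indicator_of_notMem ht, smul_zero]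
  simp_rw [h3]
  rw [integral_indicator measurableSet_Ioi, integral_sub (hint a ha) (hint b hb), key a ha, key b hb]
  field_simp
  ring

/-- The inverse Laplace transform of `1 / ((w + a) (w + b))` at time `1`. -/
theorem integral_exp_mul_resolvent_two {a b : ℝ} (ha : 0 < a) (hb : 0 < b) (hab : a ≠ b) :
    ∫ t : ℝ, Complex.exp (t * Complex.I) *
        ((a + t * Complex.I : ℂ)⁻¹ * (b + t * Complex.I : ℂ)⁻¹) =
      2 * Real.pi * ((Complex.exp (-a) - Complex.exp (-b)) / (b - a)) := by
  have hba : (b - a : ℂ) ≠ 0 := by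
    rw [← Complex.ofReal_sub, Complex.ofReal_ne_zero, sub_ne_zero]
    exact hab.symm
  have hint : Integrable (FourierTransform.fourier (causalDiff a b)) := by
    have h := integrable_resolvent_prod le_rfl (a := ![a, b]) (by simp [Fin.forall_fin_two, ha, hb]) 0
    have h2 := ((h.comp_mul_left' (R := 2 * Real.pi) (by positivity)).norm).const_mul ‖(b - a : ℂ)‖
    refine h2.mono' ?_ (ae_of_all _ fun ξ => ?_)
    · exact (VectorFourier.fourierIntegral_continuous Real.continuous_fourierChar
        (by exact continuous_inner) (integrable_causalDiff ha hb)).aestronglyMeasurable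
    · rw [fourier_causalDiff ha hb, norm_mul, norm_mul (Complex.exp _)]
      rw [zero_add, Complex.norm_exp_ofReal_mul_I, one_mul]
      simp [Fin.prod_univ_two, mul_comm]
  -- Each causal exponential jumps at `0`, but their difference is continuous, so Fourier inversion
  -- holds at every point; it is evaluated at time `1`.
  have hcont : Continuous (causalDiff a b) := by
    unfold causalDiff
    fun_prop
  have h := congrFun (hcont.fourierInv_fourier_eq (integrable_causalDiff ha hb) hint) 1
  rw [Real.fourierInv_eq'] at h
  simp_rw [fourier_causalDiff ha hb] at h
  have h4 := Measure.integral_comp_mul_left (fun t : ℝ => (b - a : ℂ) * (Complex.exp (t * Complex.I) *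
    ((a + t * Complex.I : ℂ)⁻¹ * (b + t * Complex.I : ℂ)⁻¹))) (2 * Real.pi)
  have h5 : ∀ ξ : ℝ, Complex.exp ((2 * Real.pi * inner ℝ ξ 1 : ℝ) * Complex.I) •
      ((b - a) * ((a + (2 * Real.pi * ξ : ℝ) * Complex.I : ℂ)⁻¹ *
        (b + (2 * Real.pi * ξ : ℝ) * Complex.I : ℂ)⁻¹)) =
      (b - a : ℂ) * (Complex.exp ((2 * Real.pi * ξ : ℝ) * Complex.I) *
        ((a + (2 * Real.pi * ξ : ℝ) * Complex.I : ℂ)⁻¹ *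
          (b + (2 * Real.pi * ξ : ℝ) * Complex.I : ℂ)⁻¹)) := by
    intro ξ
    simp
    ring
  simp_rw [h5] at h
  rw [h4, integral_const_mul, abs_of_pos (by positivity), Complex.real_smul] at h
  simp only [causalDiff, max_eq_left zero_le_one, Complex.ofReal_one, mul_one] at h
  rw [mul_div_assoc', eq_div_iff hba, ← h]
  rw [Complex.ofReal_inv, Complex.ofReal_mul, Complex.ofReal_ofNat, ← mul_assoc, ← mul_assoc,
    mul_inv_cancel₀ (by simp), one_mul, mul_comm]

/-- `(-r)ⁿ ∫ e^w ∏ (α_j r + w)⁻¹`, over the line `w = δ + iλ`. -/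
noncomputable def contour {n : ℕ} (r δ : ℝ) (α : Fin (n + 1) → ℝ) : ℂ :=
  ∫ t : ℝ, ((-r : ℂ) ^ n * Complex.exp (δ + t * Complex.I)) *
    ∏ j, (α j * r + (δ + t * Complex.I) : ℂ)⁻¹

theorem contour_eq {n : ℕ} (r δ : ℝ) (α : Fin (n + 1) → ℝ) :
    contour r δ α = (-r : ℂ) ^ n * ∫ t : ℝ, Complex.exp (δ + t * Complex.I) *
      ∏ j, ((α j * r + δ : ℝ) + t * Complex.I : ℂ)⁻¹ := by
  rw [contour, ← integral_const_mul]
  refine integral_congr_ae (ae_of_all _ fun t => ?_)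
  simp only [mul_assoc]
  push_cast
  simp only [add_assoc]

/-- Divided differences of exponentials as contour integrals. -/
theorem contour_eq_quotient {r δ : ℝ} (hr : 0 < r) {n : ℕ} (hn : 1 ≤ n) :
    ∀ {α : Fin (n + 1) → ℝ}, Function.Injective α → (∀ j, 0 < α j * r + δ) →
      contour r δ α = 2 * Real.pi * quotient (fun t => Complex.exp (-(r * t : ℝ))) n α := by
  have hr0 : (r : ℂ) ≠ 0 := Complex.ofReal_ne_zero.2 hr.ne'
  -- The induction starts at `1` because a single resolvent is not absolutely integrable along the
  -- line.
  induction n, hn using Nat.le_induction with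
  | base =>
    intro α hα hpos
    have hne : α 0 ≠ α 1 := fun h => by simpa using hα h
    have h := integral_exp_mul_resolvent_two (hpos 0) (hpos 1) (by
      intro h
      exact hne (mul_right_cancel₀ hr.ne' (by linarith)))
    rw [contour_eq]
    simp only [Complex.exp_add (δ : ℂ), mul_assoc (Complex.exp δ)]
    have e0 : ∀ t : ℝ, ∏ j : Fin (1 + 1), ((α j * r + δ : ℝ) + t * Complex.I : ℂ)⁻¹ =
        ((α 0 * r + δ : ℝ) + t * Complex.I : ℂ)⁻¹ * ((α 1 * r + δ : ℝ) + t * Complex.I : ℂ)⁻¹ :=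
      fun t => Fin.prod_univ_two _
    simp only [e0]
    rw [integral_const_mul, h]
    have h1 : ∀ j, Complex.exp (-((α j * r + δ : ℝ) : ℂ)) =
        Complex.exp (-(r * α j : ℝ)) * (Complex.exp δ)⁻¹ := by
      intro j
      rw [← Complex.exp_neg, ← Complex.exp_add]
      congr 1
      push_cast
      ring
    have hd : (α 0 : ℂ) - α 1 ≠ 0 := by
      rw [← Complex.ofReal_sub, Complex.ofReal_ne_zero, sub_ne_zero]
      exact hne
    have hd2 : ((α 1 * r + δ : ℝ) : ℂ) - ((α 0 * r + δ : ℝ) : ℂ) = -(r * (α 0 - α 1)) := by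
      push_cast
      ring
    rw [h1, h1, hd2]
    simp only [quotient, Fin.init, Fin.tail, Complex.ofReal_sub]
    have e1 : (Fin.last (0 + 1) : Fin 2) = 1 := rfl
    have e2 : (Fin.succ 0 : Fin 2) = 1 := rfl
    have e3 : (Fin.castSucc 0 : Fin 2) = 0 := rfl
    rw [e1, e2, e3]
    field_simp
  | succ n hn ih =>
    intro α hα hpos
    have hi := ih (injective_init hα) fun j => hpos j.castSucc
    have ht := ih (injective_tail hα) fun j => hpos j.succ
    have hd := ends_ne hα
    rw [quotient, mul_div_assoc', mul_sub, ← hi, ← ht, eq_div_iff hd, contour_eq, contour_eq,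
      contour_eq, ← mul_sub, ← integral_sub
        (integrable_resolvent_prod hn (a := fun j => Fin.init α j * r + δ)
          (fun j => hpos j.castSucc) δ)
        (integrable_resolvent_prod hn (a := fun j => Fin.tail α j * r + δ)
          (fun j => hpos j.succ) δ), pow_succ, mul_assoc, mul_assoc]
    congr 1
    rw [mul_comm _ ((α 0 - α (Fin.last (n + 1)) : ℝ) : ℂ), ← mul_assoc, ← integral_const_mul]
    refine integral_congr_ae (ae_of_all _ fun t => ?_)
    have h0 := ofReal_add_mul_I_ne_zero (hpos 0) t
    have h1 := ofReal_add_mul_I_ne_zero (hpos (Fin.last _)) t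
    -- Dropping the last (first) factor multiplies the full product by the last (first) denominator.
    -- These denominators differ by `(α 0 - α last) r`, which supplies both the denominator of the
    -- quotient and the additional factor `-r`.
    have p0 := Fin.prod_univ_succ fun j => ((α j * r + δ : ℝ) + t * Complex.I : ℂ)⁻¹
    have p1 := Fin.prod_univ_castSucc fun j => ((α j * r + δ : ℝ) + t * Complex.I : ℂ)⁻¹
    rw [eq_inv_mul_iff_mul_eq₀ h0] at p0
    rw [eq_mul_inv_iff_mul_eq₀ h1] at p1
    simp only [Fin.init, Fin.tail]
    rw [← p0, ← p1]
    push_cast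
    ring

end DivDiff

namespace MOI

variable {H : Type*} [NormedAddCommGroup H] [InnerProductSpace ℂ H] [CompleteSpace H]

/-! ### Spectral measures -/

/-- Riesz–Markov applied to the positive functional `f ↦ ⟪u, f(x) u⟫` on the compact spectrum,
followed by push-forward to `ℝ`. -/
theorem exists_measure_integral_eq_inner_cfc {x : H →L[ℂ] H} (hx : IsSelfAdjoint x) (u : H) :
    ∃ μ : Measure ℝ, IsFiniteMeasure μ ∧ ∀ f : ℝ → ℝ, ContinuousOn f (spectrum ℝ x) →
      ((∫ t, f t ∂μ : ℝ) : ℂ) = ⟪u, cfc f x u⟫_ℂ := by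
  have : CompactSpace (spectrum ℝ x) := isCompact_iff_compactSpace.1 (spectrum.isCompact x)
  let L : CompactlySupportedContinuousMap (spectrum ℝ x) ℝ →ₗ[ℝ] ℝ :=
    { toFun := fun f => (⟪u, cfcHom hx (f : C(spectrum ℝ x, ℝ)) u⟫_ℂ).re
      map_add' := fun f g => by
        have : ((f + g : CompactlySupportedContinuousMap (spectrum ℝ x) ℝ) : C(spectrum ℝ x, ℝ)) =
          (f : C(spectrum ℝ x, ℝ)) + (g : C(spectrum ℝ x, ℝ)) := rfl
        rw [this, map_add]
        simp
      map_smul' := fun c f => by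
        have : ((c • f : CompactlySupportedContinuousMap (spectrum ℝ x) ℝ) : C(spectrum ℝ x, ℝ)) =
          c • (f : C(spectrum ℝ x, ℝ)) := rfl
        rw [this, map_smul]
        simp [← Complex.coe_smul] }
  let Λ : CompactlySupportedContinuousMap (spectrum ℝ x) ℝ →ₚ[ℝ] ℝ :=
    PositiveLinearMap.mk₀ L fun f hf => by
      have h1 : 0 ≤ cfcHom hx (f : C(spectrum ℝ x, ℝ)) :=
        (cfcHom_nonneg_iff hx).2 fun t => hf t
      have h2 := (ContinuousLinearMap.nonneg_iff_isPositive _).1 h1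
      exact (Complex.le_def.1 (h2.inner_nonneg_right u)).1
  let ρ := RealRMK.rieszMeasure Λ
  have hreal : ∀ g : C(spectrum ℝ x, ℝ), (⟪u, cfcHom hx g u⟫_ℂ).im = 0 := by
    intro g
    have h1 : IsSelfAdjoint (cfcHom hx g) := by
      have : IsSelfAdjoint g := by
        ext t
        rfl
      exact this.map (cfcHom hx)
    exact (ContinuousLinearMap.isSelfAdjoint_iff_isSymmetric.1 h1).im_inner_self_apply u
  have hfin : IsFiniteMeasure ρ := ⟨isCompact_univ.measure_lt_top⟩
  refine ⟨ρ.map Subtype.val, inferInstance, fun f hf => ?_⟩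
  have hmeas : MeasurableEmbedding (Subtype.val : spectrum ℝ x → ℝ) :=
    MeasurableEmbedding.subtype_coe (spectrum.isCompact x).measurableSet
  rw [hmeas.integral_map, cfc_apply f x hx hf]
  let g : CompactlySupportedContinuousMap (spectrum ℝ x) ℝ :=
    ⟨⟨(spectrum ℝ x).domRestrict f, hf.domRestrict⟩, HasCompactSupport.of_compactSpace _⟩
  have h := RealRMK.integral_rieszMeasure Λ g
  refine Complex.ext ?_ ?_
  · exact h
  · exact (hreal _).symm

theorem exists_isSpectralMeasure {x : H →L[ℂ] H} (hx : IsSelfAdjoint x) (u : H) :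
    ∃ μ, IsSpectralMeasure x u μ := by
  obtain ⟨μ, hμ, h⟩ := exists_measure_integral_eq_inner_cfc hx u
  exact ⟨μ, hμ, fun f => h _ f.continuous.continuousOn⟩

theorem IsSpectralMeasure.unique {x : H →L[ℂ] H} {u : H} {μ ν : Measure ℝ}
    (hμ : IsSpectralMeasure x u μ) (hν : IsSpectralMeasure x u ν) : μ = ν := by
  have := hμ.1
  have := hν.1
  refine ext_of_forall_integral_eq_of_IsFiniteMeasure fun f => ?_
  exact Complex.ofReal_injective ((hμ.2 f).trans (hν.2 f).symm)

open Classical in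
/-- The spectral measure of `x` at `u`. -/
noncomputable def specMeasure (x : H →L[ℂ] H) (u : H) : Measure ℝ :=
  if h : ∃ μ, IsSpectralMeasure x u μ then h.choose else 0

theorem isSpectralMeasure_specMeasure {x : H →L[ℂ] H} (hx : IsSelfAdjoint x) (u : H) :
    IsSpectralMeasure x u (specMeasure x u) := by
  have h := exists_isSpectralMeasure hx u
  rw [specMeasure, dif_pos h]
  exact h.choose_spec

instance (x : H →L[ℂ] H) (u : H) : IsFiniteMeasure (specMeasure x u) := by
  unfold specMeasure
  split_ifs with h
  · exact h.choose_spec.1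
  · infer_instance

theorem isBorelCalculus_iff {x : H →L[ℂ] H} (hx : IsSelfAdjoint x) {g : ℝ → ℂ} {G : H →L[ℂ] H} :
    IsBorelCalculus x g G ↔ ∀ u, ⟪u, G u⟫_ℂ = ∫ t, g t ∂specMeasure x u := by
  constructor
  · intro h u
    obtain ⟨μ, hμ, e⟩ := h u
    rw [e, hμ.unique (isSpectralMeasure_specMeasure hx u)]
  · exact fun h u => ⟨_, isSpectralMeasure_specMeasure hx u, h u⟩

theorem integral_specMeasure {x : H →L[ℂ] H} (hx : IsSelfAdjoint x) (u : H) {f : ℝ → ℝ}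
    (hf : ContinuousOn f (spectrum ℝ x)) :
    ((∫ t, f t ∂specMeasure x u : ℝ) : ℂ) = ⟪u, cfc f x u⟫_ℂ := by
  obtain ⟨μ, hμ, h⟩ := exists_measure_integral_eq_inner_cfc hx u
  rw [(isSpectralMeasure_specMeasure hx u).unique
    (⟨hμ, fun f => h _ f.continuous.continuousOn⟩ : IsSpectralMeasure x u μ)]
  exact h f hf

/-- The truncated distance to the spectrum vanishes on the spectrum, so its integral is `0`. An
empty spectrum is treated apart since `Metric.infDist` to the empty set is `0` everywhere; there the
functions `1` and `0` agree on the spectrum and the measure has no mass. -/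
theorem ae_mem_spectrum {x : H →L[ℂ] H} (hx : IsSelfAdjoint x) (u : H) :
    ∀ᵐ t ∂specMeasure x u, t ∈ spectrum ℝ x := by
  rcases (spectrum ℝ x).eq_empty_or_nonempty with he | hne
  · have h := integral_specMeasure hx u (f := fun _ => 1) continuousOn_const
    have h2 := integral_specMeasure hx u (f := fun _ => 0) continuousOn_const
    rw [cfc_congr (g := fun _ => 0) (by rw [he]; exact Set.eqOn_empty _ _), ← h2] at h
    simp only [integral_const, smul_eq_mul, mul_one, mul_zero, Complex.ofReal_inj] at h
    rw [Measure.real, ENNReal.toReal_eq_zero_iff] at h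
    have h3 : specMeasure x u = 0 :=
      Measure.measure_univ_eq_zero.1 (h.resolve_right (measure_ne_top _ _))
    rw [h3]
    exact ae_zero.symm ▸ eventually_bot
  · let f : ℝ → ℝ := fun t => min 1 (Metric.infDist t (spectrum ℝ x))
    have hcont : Continuous f := continuous_const.min (Metric.continuous_infDist_pt _)
    have hnn : ∀ t, 0 ≤ f t := fun t => le_min zero_le_one Metric.infDist_nonneg
    have h := integral_specMeasure hx u hcont.continuousOn
    have h2 := integral_specMeasure hx u (f := fun _ => 0) continuousOn_const
    rw [cfc_congr (g := fun _ => 0) (fun t ht => by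
      simp [f, Metric.infDist_zero_of_mem ht]), ← h2] at h
    rw [integral_zero, Complex.ofReal_inj, integral_eq_zero_iff_of_nonneg hnn] at h
    · filter_upwards [h] with t ht
      have h3 : Metric.infDist t (spectrum ℝ x) = 0 := by
        by_contra hcon
        have : 0 < Metric.infDist t (spectrum ℝ x) := lt_of_le_of_ne Metric.infDist_nonneg (Ne.symm hcon)
        exact (lt_min one_pos this).ne' ht
      exact ((spectrum.isCompact x).isClosed.mem_iff_infDist_zero hne).2 h3
    · refine (integrable_const (1 : ℝ)).mono' hcont.aestronglyMeasurable (ae_of_all _ fun t => ?_)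
      rw [Real.norm_of_nonneg (hnn t)]
      exact min_le_left _ _

theorem specMeasure_real_univ {x : H →L[ℂ] H} (hx : IsSelfAdjoint x) (u : H) :
    (specMeasure x u).real Set.univ = ‖u‖ ^ 2 := by
  have h := integral_specMeasure hx u (f := fun _ => 1) continuousOn_const
  rw [cfc_const_one ℝ x] at h
  rw [one_apply_eq_self, inner_self_eq_norm_sq_to_K] at h
  simp only [integral_const, smul_eq_mul, mul_one] at h
  exact Complex.ofReal_injective (h.trans (by simp))

theorem inner_cfc {x : H →L[ℂ] H} (hx : IsSelfAdjoint x) (u : H) {f : ℂ → ℂ}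
    (hf : ContinuousOn f (spectrum ℂ x)) :
    ⟪u, cfc f x u⟫_ℂ = ∫ t, f (t : ℂ) ∂specMeasure x u := by
  have hsp : ∀ t ∈ spectrum ℝ x, (t : ℂ) ∈ spectrum ℂ x := fun t ht =>
    spectrum.algebraMap_mem ℂ ht
  have hre : ContinuousOn (fun t : ℝ => (f t).re) (spectrum ℝ x) :=
    Complex.continuous_re.comp_continuousOn
      (hf.comp Complex.continuous_ofReal.continuousOn hsp)
  have him : ContinuousOn (fun t : ℝ => (f t).im) (spectrum ℝ x) :=
    Complex.continuous_im.comp_continuousOn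
      (hf.comp Complex.continuous_ofReal.continuousOn hsp)
  have e : cfc f x = cfc (fun t : ℝ => (f t).re) x + Complex.I • cfc (fun t : ℝ => (f t).im) x := by
    have hN : IsStarNormal x := hx.isStarNormal
    have hz : ∀ z ∈ spectrum ℂ x, ((z.re : ℝ) : ℂ) = z := fun z hz =>
      (hx.mem_spectrum_eq_re hz).symm
    have c1 : ContinuousOn (fun z : ℂ => ((f (z.re : ℝ)).re : ℂ)) (spectrum ℂ x) :=
      (Complex.continuous_ofReal.comp Complex.continuous_re).comp_continuousOn
        (hf.congr fun z h => by rw [hz z h])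
    have c2 : ContinuousOn (fun z : ℂ => ((f (z.re : ℝ)).im : ℂ)) (spectrum ℂ x) :=
      (Complex.continuous_ofReal.comp Complex.continuous_im).comp_continuousOn
        (hf.congr fun z h => by rw [hz z h])
    rw [cfc_real_eq_complex _ hx, cfc_real_eq_complex _ hx, ← cfc_smul Complex.I _ x c2,
      ← cfc_add x _ (fun z : ℂ => Complex.I • ((f (z.re : ℝ)).im : ℂ)) c1 (c2.const_smul Complex.I)]
    refine cfc_congr fun z h => ?_
    simp only [smul_eq_mul]
    rw [mul_comm Complex.I, Complex.re_add_im, hz z h]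
  have hbdd : ∀ {g : ℝ → ℝ}, ContinuousOn g (spectrum ℝ x) → Integrable g (specMeasure x u) := by
    intro g hg
    have h1 : IntegrableOn g (spectrum ℝ x) (specMeasure x u) :=
      hg.integrableOn_compact (spectrum.isCompact x)
    rwa [IntegrableOn, Measure.restrict_eq_self_of_ae_mem (ae_mem_spectrum hx u)] at h1
  rw [e, add_apply, smul_apply, inner_add_right,
    inner_smul_right, ← integral_specMeasure hx u hre, ← integral_specMeasure hx u him,
    ← integral_complex_ofReal, ← integral_complex_ofReal, ← integral_const_mul,
    ← integral_add (hbdd hre).ofReal ((hbdd him).ofReal.const_mul _)]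
  refine integral_congr_ae (ae_of_all _ fun t => ?_)
  simp only
  rw [mul_comm Complex.I, Complex.re_add_im]

end MOI

/-! ### Polarization and norm bounds for the Borel calculus -/

namespace MOI

section

variable {H : Type*} [NormedAddCommGroup H] [InnerProductSpace ℂ H]

theorem inner_eq_sum_polarization (G : H →L[ℂ] H) (u v : H) :
    ⟪u, G v⟫_ℂ = ∑ k : Fin 4, ((-Complex.I) ^ (k : ℕ) / 4) *
      ⟪u + Complex.I ^ (k : ℕ) • v, G (u + Complex.I ^ (k : ℕ) • v)⟫_ℂ := by
  have h2 : Complex.I ^ 2 = -1 := Complex.I_sq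
  have h3 : Complex.I ^ 3 = -Complex.I := by rw [pow_succ, h2]; ring
  simp only [Fin.sum_univ_four, Fin.val_zero, Fin.val_one, Fin.val_two, pow_zero, pow_one,
    map_add, map_smul, inner_add_left, inner_add_right, inner_smul_left, inner_smul_right]
  have e3 : ((3 : Fin 4) : ℕ) = 3 := rfl
  rw [e3]
  rw [neg_pow Complex.I, neg_pow Complex.I, h2, h3]
  simp only [map_one, map_neg, Complex.conj_I]
  linear_combination (⟪u, G v⟫_ℂ - ⟪v, G u⟫_ℂ) / 2 * h2

variable [CompleteSpace H]

theorem IsBorelCalculus.inner_eq {x : H →L[ℂ] H} (hx : IsSelfAdjoint x) {g : ℝ → ℂ}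
    {G : H →L[ℂ] H} (h : IsBorelCalculus x g G) (u v : H) :
    ⟪u, G v⟫_ℂ = ∑ k : Fin 4, ((-Complex.I) ^ (k : ℕ) / 4) *
      ∫ t, g t ∂specMeasure x (u + Complex.I ^ (k : ℕ) • v) := by
  rw [inner_eq_sum_polarization]
  simp only [(isBorelCalculus_iff hx).1 h]

/-- For unit `u, v` each of the four polarization terms has weight `1/4` and a spectral measure of
mass at most `2²`. The factor `4` is crude; only a bound uniform in the parameter is needed. -/
theorem IsBorelCalculus.norm_le {x : H →L[ℂ] H} (hx : IsSelfAdjoint x) {g : ℝ → ℂ}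
    {G : H →L[ℂ] H} (h : IsBorelCalculus x g G) {C : ℝ} (hC : ∀ t, ‖g t‖ ≤ C) : ‖G‖ ≤ 4 * C := by
  have hC0 : 0 ≤ C := (norm_nonneg _).trans (hC 0)
  have h1 : ∀ u v : H, ‖u‖ = 1 → ‖v‖ = 1 → ‖⟪u, G v⟫_ℂ‖ ≤ 4 * C := by
    intro u v hu hv
    rw [h.inner_eq hx]
    refine (norm_sum_le _ _).trans ((Finset.sum_le_card_nsmul _ _ C fun k _ => ?_).trans (by simp))
    have h2 : ‖∫ t, g t ∂specMeasure x (u + Complex.I ^ (k : ℕ) • v)‖ ≤ C * 2 ^ 2 := by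
      refine (norm_integral_le_of_norm_le_const (ae_of_all _ hC)).trans ?_
      rw [specMeasure_real_univ hx]
      have h3 : ‖u + Complex.I ^ (k : ℕ) • v‖ ≤ 2 := by
        refine (norm_add_le _ _).trans ?_
        rw [norm_smul, norm_pow, Complex.norm_I, one_pow, hu, hv]
        norm_num
      gcongr
    rw [norm_mul, norm_div, norm_pow, norm_neg, Complex.norm_I, one_pow]
    have h4 : ‖(4 : ℂ)‖ = 4 := by norm_num
    rw [h4]
    linarith
  refine ContinuousLinearMap.opNorm_le_of_unit_norm (by positivity) fun v hv => ?_
  rcases eq_or_ne (G v) 0 with h0 | h0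
  · rw [h0, norm_zero]
    positivity
  · have h5 := h1 (((‖G v‖⁻¹ : ℝ) : ℂ) • G v) v (by
      rw [norm_smul, Complex.norm_real, norm_inv, norm_norm, inv_mul_cancel₀ (norm_ne_zero_iff.2 h0)]) hv
    rw [inner_smul_left, inner_self_eq_norm_sq_to_K, norm_mul, Complex.conj_ofReal,
      Complex.norm_real] at h5
    refine le_trans (le_of_eq ?_) h5
    have h6 : ‖G v‖ ≠ 0 := norm_ne_zero_iff.2 h0
    rw [norm_pow]
    simp
    field_simp

end

/-! ### Alternating products -/

variable {H : Type*} [NormedAddCommGroup H] [InnerProductSpace ℂ H]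

theorem altProd_zero (A : Fin 1 → (H →L[ℂ] H)) (V : Fin 0 → (H →L[ℂ] H)) :
    altProd A V = A 0 := by
  simp [altProd]

theorem altProd_succ {n : ℕ} (A : Fin (n + 2) → (H →L[ℂ] H)) (V : Fin (n + 1) → (H →L[ℂ] H)) :
    altProd A V = A 0 * V 0 * altProd (fun j => A j.succ) (fun i => V i.succ) := by
  simp [altProd, List.ofFn_succ, mul_assoc]

theorem norm_altProd_le {n : ℕ} (A : Fin (n + 1) → (H →L[ℂ] H)) (V : Fin n → (H →L[ℂ] H)) :
    ‖altProd A V‖ ≤ (∏ j, ‖A j‖) * ∏ i, ‖V i‖ := by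
  induction n with
  | zero => simp [altProd_zero]
  | succ n ih =>
    rw [altProd_succ, Fin.prod_univ_succ, Fin.prod_univ_succ (fun i => ‖V i‖)]
    refine (norm_mul_le _ _).trans ?_
    refine (mul_le_mul (norm_mul_le _ _) (ih _ _) (norm_nonneg _) (by positivity)).trans
      (le_of_eq ?_)
    ring

theorem altProd_smul {n : ℕ} (c : Fin (n + 1) → ℂ) (A : Fin (n + 1) → (H →L[ℂ] H))
    (V : Fin n → (H →L[ℂ] H)) : altProd (fun j => c j • A j) V = (∏ j, c j) • altProd A V := by
  induction n with
  | zero => simp [altProd_zero]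
  | succ n ih =>
    rw [altProd_succ, altProd_succ, ih, Fin.prod_univ_succ c, mul_comm]
    simp only [smul_mul_assoc, mul_smul_comm, smul_smul]

/-- The alternating product is multilinear in the interior operators. -/
theorem altProd_sum {n : ℕ} {ι : Type*} (s : Finset ι) (A : Fin (n + 1) → (H →L[ℂ] H))
    (W : Fin n → ι → (H →L[ℂ] H)) :
    altProd A (fun i => ∑ m ∈ s, W i m) =
      ∑ m ∈ Fintype.piFinset fun _ : Fin n => s, altProd A fun i => W i (m i) := by
  have h := (((MultilinearMap.mkPiAlgebraFin ℂ n (H →L[ℂ] H)).compLinearMap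
    fun i => LinearMap.mulRight ℂ (A i.succ))).map_sum_finset W fun _ => s
  simp only [MultilinearMap.compLinearMap_apply, MultilinearMap.mkPiAlgebraFin_apply,
    LinearMap.mulRight_apply] at h
  simp only [altProd]
  rw [h, Finset.mul_sum]

/-- Each rank one operator cuts the product, leaving one scalar matrix coefficient per `A j`. -/
theorem inner_altProd_rankOne {n : ℕ} (A : Fin (n + 1) → (H →L[ℂ] H)) (L R : Fin (n + 1) → H) :
    ⟪L 0, altProd A (fun i => InnerProductSpace.rankOne ℂ (R i.castSucc) (L i.succ))
      (R (Fin.last n))⟫_ℂ = ∏ j, ⟪L j, A j (R j)⟫_ℂ := by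
  induction n with
  | zero => simp [altProd_zero]
  | succ n ih =>
    have h := ih (fun j => A j.succ) (fun j => L j.succ) (fun j => R j.succ)
    simp only [Fin.succ_castSucc, Fin.succ_last] at h
    rw [Fin.prod_univ_succ, ← h, altProd_succ]
    simp [mul_comm]

theorem continuous_altProd {Ω : Type*} [TopologicalSpace Ω] {n : ℕ}
    {A : Fin (n + 1) → Ω → (H →L[ℂ] H)} (hA : ∀ j, Continuous (A j)) (V : Fin n → (H →L[ℂ] H)) :
    Continuous fun ω => altProd (fun j => A j ω) V := by
  induction n with
  | zero => simpa [altProd_zero] using hA 0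
  | succ n ih =>
    simp only [altProd_succ]
    exact ((hA 0).mul continuous_const).mul (ih (fun j => hA j.succ) _)

/-! ### Finite rank approximation -/

section Approx

variable {ι : Type*} (e : HilbertBasis ι ℂ H)

/-- The orthogonal projection onto the span of `e i`, `i ∈ s`. -/
noncomputable def finProj (s : Finset ι) : H →L[ℂ] H :=
  ∑ m ∈ s, InnerProductSpace.rankOne ℂ (e m) (e m)

theorem norm_finProj_le (s : Finset ι) : ‖finProj e s‖ ≤ 1 := by
  refine ContinuousLinearMap.opNorm_le_bound _ zero_le_one fun z => ?_
  rw [one_mul]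
  refine le_of_sq_le_sq ?_ (norm_nonneg _)
  refine le_trans (le_of_eq ?_) (e.orthonormal.sum_inner_products_le z (s := s))
  have h : finProj e s z = ∑ m ∈ s, ⟪e m, z⟫_ℂ • e m := by simp [finProj]
  have h2 := e.orthonormal.inner_sum (fun m => ⟪e m, z⟫_ℂ) (fun m => ⟪e m, z⟫_ℂ) s
  rw [← h, inner_self_eq_norm_sq_to_K] at h2
  have h3 : ((‖finProj e s z‖ ^ 2 : ℝ) : ℂ) = ((∑ m ∈ s, ‖⟪e m, z⟫_ℂ‖ ^ 2 : ℝ) : ℂ) := by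
    push_cast
    refine h2.trans (Finset.sum_congr rfl fun m _ => ?_)
    rw [← Complex.normSq_eq_conj_mul_self, Complex.normSq_eq_norm_sq]
    push_cast
    rfl
  exact Complex.ofReal_injective h3

theorem tendsto_finProj (z : H) : Tendsto (fun s => finProj e s z) atTop (𝓝 z) := by
  have h := e.hasSum_repr z
  refine Tendsto.congr (fun s => ?_) h
  simp [finProj, e.repr_apply_apply]

/-- The projections act on vectors that themselves vary with `s`, so the uniform bound `‖finProj e
s‖ ≤ 1` is needed besides strong convergence. -/
theorem tendsto_altProd_finProj {n : ℕ} (A : Fin (n + 1) → (H →L[ℂ] H)) (V : Fin n → (H →L[ℂ] H))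
    (v : H) : Tendsto (fun s => altProd A (fun i => finProj e s * V i) v) atTop
      (𝓝 (altProd A V v)) := by
  induction n with
  | zero => simp [altProd_zero]
  | succ n ih =>
    simp only [altProd_succ]
    have h1 := ih (fun j => A j.succ) (fun i => V i.succ)
    simp only [ContinuousLinearMap.mul_def, ContinuousLinearMap.comp_apply] at *
    set y := altProd (fun j => A j.succ) (fun i => V i.succ) v
    refine ((A 0).continuous.tendsto _).comp ?_
    have h2 := ((V 0).continuous.tendsto _).comp h1
    have h3 := tendsto_finProj e (V 0 y)
    rw [tendsto_iff_norm_sub_tendsto_zero] at h2 h3 ⊢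
    refine squeeze_zero (fun _ => norm_nonneg _) (fun s => ?_) (by simpa using h2.add h3)
    have h4 : ∀ w : H, finProj e s w - V 0 y = finProj e s (w - V 0 y) + (finProj e s (V 0 y) - V 0 y) := by
      intro w
      rw [map_sub]
      abel
    rw [h4]
    refine (norm_add_le _ _).trans (add_le_add ?_ le_rfl)
    exact ((finProj e s).le_of_opNorm_le (norm_finProj_le e s) _).trans (by simp)

end Approx

end MOI

namespace MOI

variable {H : Type*} [NormedAddCommGroup H] [InnerProductSpace ℂ H] [CompleteSpace H]

/-! ### Independence of the separation of variables -/

/-- The multiple operator integral of the symbol `φ` at rank one operators, as a combination of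
integrals of `φ` against products of spectral measures. -/
noncomputable def rankOneMOI {n : ℕ} (x : H →L[ℂ] H) (φ : (Fin (n + 1) → ℝ) → ℂ)
    (L R : Fin (n + 1) → H) : ℂ :=
  ∑ κ : Fin (n + 1) → Fin 4, (∏ j, (-Complex.I) ^ (κ j : ℕ) / 4) *
    ∫ α, φ α ∂Measure.pi fun j => specMeasure x (L j + Complex.I ^ (κ j : ℕ) • R j)

section Separation

variable {x : H →L[ℂ] H} {n : ℕ} {Ω : Type*} {a : Fin (n + 1) → ℝ → Ω → ℂ} {A : Fin (n + 1) → Ω → (H →L[ℂ] H)}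
  {φ : (Fin (n + 1) → ℝ) → ℂ} {C : ℝ}

theorem prod_inner_eq (hx : IsSelfAdjoint x)
    (hA : ∀ j ω, IsBorelCalculus x (fun t => a j t ω) (A j ω)) (L R : Fin (n + 1) → H) (ω : Ω) :
    ∏ j, ⟪L j, A j ω (R j)⟫_ℂ = ∑ κ : Fin (n + 1) → Fin 4,
      (∏ j, (-Complex.I) ^ (κ j : ℕ) / 4) * ∫ α, ∏ j, a j (α j) ω
        ∂Measure.pi fun j => specMeasure x (L j + Complex.I ^ (κ j : ℕ) • R j) := by
  simp only [fun j => (hA j ω).inner_eq hx (L j) (R j)]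
  rw [Finset.prod_univ_sum, Fintype.piFinset_univ]
  refine Finset.sum_congr rfl fun κ _ => ?_
  rw [Finset.prod_mul_distrib]
  congr 1
  exact (integral_fintype_prod_eq_prod fun j t => a j t ω).symm

variable [MeasurableSpace Ω] {μ : Measure Ω} [IsFiniteMeasure μ]

theorem integrable_uncurry_prod (ha : ∀ j, Measurable (Function.uncurry (a j)))
    (hC : ∀ j t ω, ‖a j t ω‖ ≤ C) (ν : Measure (Fin (n + 1) → ℝ)) [IsFiniteMeasure ν] :
    Integrable (Function.uncurry fun ω (α : Fin (n + 1) → ℝ) => ∏ j, a j (α j) ω) (μ.prod ν) := by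
  refine (integrable_const (C ^ (n + 1))).mono' ?_ (ae_of_all _ fun p => ?_)
  · refine Measurable.aestronglyMeasurable ?_
    refine Finset.measurable_prod _ fun j _ => ?_
    have h : Measurable fun p : Ω × (Fin (n + 1) → ℝ) => (p.2 j, p.1) := by fun_prop
    exact (ha j).comp h
  · rw [Function.uncurry, norm_prod]
    refine (Finset.prod_le_prod (fun _ _ => norm_nonneg _) fun j _ => hC j _ _).trans ?_
    simp

/-- After polarization, Fubini moves the integral over `Ω` inside, where it reproduces `φ`. The
spectral measures live on the spectrum, so the right side no longer involves the separation of
variables. -/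
theorem integral_prod_inner (hx : IsSelfAdjoint x)
    (ha : ∀ j, Measurable (Function.uncurry (a j))) (hC : ∀ j t ω, ‖a j t ω‖ ≤ C)
    (hφ : ∀ α : Fin (n + 1) → ℝ, (∀ j, α j ∈ spectrum ℝ x) → φ α = ∫ ω, ∏ j, a j (α j) ω ∂μ)
    (hA : ∀ j ω, IsBorelCalculus x (fun t => a j t ω) (A j ω)) (L R : Fin (n + 1) → H) :
    Integrable (fun ω => ∏ j, ⟪L j, A j ω (R j)⟫_ℂ) μ ∧
      ∫ ω, ∏ j, ⟪L j, A j ω (R j)⟫_ℂ ∂μ = rankOneMOI x φ L R := by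
  simp only [prod_inner_eq hx hA]
  have hint : ∀ κ : Fin (n + 1) → Fin 4, Integrable (fun ω =>
      (∏ j, (-Complex.I) ^ (κ j : ℕ) / 4) * ∫ α, ∏ j, a j (α j) ω
        ∂Measure.pi fun j => specMeasure x (L j + Complex.I ^ (κ j : ℕ) • R j)) μ := fun κ =>
    (integrable_uncurry_prod ha hC _).integral_prod_left.const_mul _
  refine ⟨integrable_finsetSum _ fun κ _ => hint κ, ?_⟩
  rw [integral_finsetSum _ fun κ _ => hint κ, rankOneMOI]
  refine Finset.sum_congr rfl fun κ _ => ?_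
  rw [integral_const_mul, integral_integral_swap (integrable_uncurry_prod ha hC _)]
  congr 1
  refine integral_congr_ae ?_
  have hae : ∀ᵐ α ∂Measure.pi fun j => specMeasure x (L j + Complex.I ^ (κ j : ℕ) • R j),
      ∀ j, α j ∈ spectrum ℝ x := ae_all_iff.2 fun j =>
    (Measure.quasiMeasurePreserving_eval _ j).ae (ae_mem_spectrum hx _)
  filter_upwards [hae] with α hα
  exact (hφ α hα).symm

variable {ι : Type*} (e : HilbertBasis ι ℂ H)

/-- The multiple operator integral of `φ` at the finite rank operators `finProj e s * V i`. -/
noncomputable def finRankMOI (x : H →L[ℂ] H) (φ : (Fin (n + 1) → ℝ) → ℂ)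
    (V : Fin n → (H →L[ℂ] H)) (u v : H) (s : Finset ι) : ℂ :=
  ∑ m ∈ Fintype.piFinset fun _ : Fin n => s,
    rankOneMOI x φ (Fin.cons u fun i => ContinuousLinearMap.adjoint (V i) (e (m i)))
      (Fin.snoc (fun i => e (m i)) v : Fin (n + 1) → H)

theorem integral_altProd_finProj (hx : IsSelfAdjoint x)
    (ha : ∀ j, Measurable (Function.uncurry (a j))) (hC : ∀ j t ω, ‖a j t ω‖ ≤ C)
    (hφ : ∀ α : Fin (n + 1) → ℝ, (∀ j, α j ∈ spectrum ℝ x) → φ α = ∫ ω, ∏ j, a j (α j) ω ∂μ)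
    (hA : ∀ j ω, IsBorelCalculus x (fun t => a j t ω) (A j ω)) (V : Fin n → (H →L[ℂ] H))
    (u v : H) (s : Finset ι) :
    Integrable (fun ω => ⟪u, altProd (fun j => A j ω) (fun i => finProj e s * V i) v⟫_ℂ) μ ∧
      ∫ ω, ⟪u, altProd (fun j => A j ω) (fun i => finProj e s * V i) v⟫_ℂ ∂μ =
        finRankMOI e x φ V u v s := by
  have h1 : ∀ i, finProj e s * V i = ∑ m ∈ s,
      InnerProductSpace.rankOne ℂ (e m) (ContinuousLinearMap.adjoint (V i) (e m)) := by
    intro i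
    ext z
    simp [finProj, ContinuousLinearMap.adjoint_inner_left]
  have h2 : ∀ ω, ⟪u, altProd (fun j => A j ω) (fun i => finProj e s * V i) v⟫_ℂ =
      ∑ m ∈ Fintype.piFinset fun _ : Fin n => s, ∏ j,
        ⟪(Fin.cons u fun i => ContinuousLinearMap.adjoint (V i) (e (m i)) : Fin (n + 1) → H) j,
          A j ω ((Fin.snoc (fun i => e (m i)) v : Fin (n + 1) → H) j)⟫_ℂ := by
    intro ω
    simp only [h1]
    rw [altProd_sum, sum_apply, inner_sum]
    refine Finset.sum_congr rfl fun m _ => ?_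
    rw [← inner_altProd_rankOne]
    simp
  simp only [h2]
  have h3 := fun m : Fin n → ι => integral_prod_inner hx ha hC hφ hA
    (Fin.cons u fun i => ContinuousLinearMap.adjoint (V i) (e (m i)))
    (Fin.snoc (fun i => e (m i)) v : Fin (n + 1) → H)
  refine ⟨integrable_finsetSum _ fun m _ => (h3 m).1, ?_⟩
  rw [integral_finsetSum _ fun m _ => (h3 m).1]
  exact Finset.sum_congr rfl fun m _ => (h3 m).2

/-- The functions on the left depend only on the symbol, so the limit does too. Countability of the
basis makes `atTop` on its finite subsets countably generated, as dominated convergence requires. -/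
theorem tendsto_finRankMOI [Countable ι] (hx : IsSelfAdjoint x)
    (ha : ∀ j, Measurable (Function.uncurry (a j))) (hC : ∀ j t ω, ‖a j t ω‖ ≤ C)
    (hφ : ∀ α : Fin (n + 1) → ℝ, (∀ j, α j ∈ spectrum ℝ x) → φ α = ∫ ω, ∏ j, a j (α j) ω ∂μ)
    (hA : ∀ j ω, IsBorelCalculus x (fun t => a j t ω) (A j ω)) (V : Fin n → (H →L[ℂ] H))
    (u v : H) :
    Tendsto (finRankMOI e x φ V u v) atTop
      (𝓝 (∫ ω, ⟪u, altProd (fun j => A j ω) V v⟫_ℂ ∂μ)) := by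
  have h := integral_altProd_finProj e hx ha hC hφ hA V u v
  refine Tendsto.congr (fun s => (h s).2) ?_
  refine tendsto_integral_filter_of_dominated_convergence
    (fun _ => ‖u‖ * (((4 * C) ^ (n + 1) * ∏ i, ‖V i‖) * ‖v‖))
    (Eventually.of_forall fun s => (h s).1.aestronglyMeasurable)
    (Eventually.of_forall fun s => ae_of_all _ fun ω => ?_) (integrable_const _)
    (ae_of_all _ fun ω => ?_)
  · refine (norm_inner_le_norm _ _).trans ?_
    gcongr
    refine (ContinuousLinearMap.le_opNorm _ _).trans ?_
    gcongr
    refine (norm_altProd_le _ _).trans ?_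
    have h1 : ∏ j, ‖A j ω‖ ≤ (4 * C) ^ (n + 1) := by
      refine (Finset.prod_le_prod (fun _ _ => norm_nonneg _) fun j _ =>
        (hA j ω).norm_le hx fun t => hC j t ω).trans ?_
      simp
    have h2 : ∀ i, ‖finProj e s * V i‖ ≤ ‖V i‖ := fun i =>
      (norm_mul_le _ _).trans (mul_le_of_le_one_left (norm_nonneg _) (norm_finProj_le e s))
    refine mul_le_mul h1 (Finset.prod_le_prod (fun _ _ => norm_nonneg _) fun i _ => h2 i)
      (Finset.prod_nonneg fun _ _ => norm_nonneg _) ((Finset.prod_nonneg fun _ _ => norm_nonneg _).trans h1)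
  · exact tendsto_const_nhds.inner (tendsto_altProd_finProj e _ V v)

end Separation

/-- The multiple operator integral only depends on the symbol on the spectrum, not on the chosen
separation of variables. -/
theorem IsMOI.unique {ι : Type*} [Countable ι] (e : HilbertBasis ι ℂ H) {x : H →L[ℂ] H}
    (hx : IsSelfAdjoint x) {n : ℕ} {φ ψ : (Fin (n + 1) → ℝ) → ℂ}
    (hφψ : ∀ α : Fin (n + 1) → ℝ, (∀ j, α j ∈ spectrum ℝ x) → φ α = ψ α)
    {V : Fin n → (H →L[ℂ] H)} {T S : H →L[ℂ] H} (hT : IsMOI x φ V T) (hS : IsMOI x ψ V S) :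
    T = S := by
  obtain ⟨Ω, _, μ, a, A, hμ, ha, ⟨C, hC⟩, hφ, hA, hT⟩ := hT
  obtain ⟨Ω', _, μ', a', A', hμ', ha', ⟨C', hC'⟩, hψ, hA', hS⟩ := hS
  refine ContinuousLinearMap.ext fun v => ext_inner_left ℂ fun u => ?_
  rw [(hT u v).2, (hS u v).2]
  refine tendsto_nhds_unique (tendsto_finRankMOI e hx ha hC hφ hA V u v)
    (tendsto_finRankMOI e hx ha' hC' (fun α hα => ?_) hA' V u v)
  rw [hφψ α hα, hψ α hα]

theorem IsMOI.moi_eq {ι : Type*} [Countable ι] (e : HilbertBasis ι ℂ H) {x : H →L[ℂ] H}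
    (hx : IsSelfAdjoint x) {n : ℕ} {φ : (Fin (n + 1) → ℝ) → ℂ} {V : Fin n → (H →L[ℂ] H)}
    {T : H →L[ℂ] H} (hT : IsMOI x φ V T) : moi x φ V = T := by
  have h : ∃ T, IsMOI x φ V T := ⟨T, hT⟩
  rw [moi, dif_pos h]
  exact h.choose_spec.unique e hx (fun _ _ => rfl) hT

end MOI

namespace MOI

/-! ### Multiple operator integrals with resolvent separation -/

/-- The data of a superposition `∫ g ∏ⱼ (αⱼ r + w)⁻¹ dν` converging absolutely for `αⱼ ≥ c`. -/
structure ResolventData {Ω : Type*} [TopologicalSpace Ω] [MeasurableSpace Ω] (ν : Measure Ω)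
    (n : ℕ) (c : ℝ) (r : Ω → ℝ) (w g : Ω → ℂ) : Prop where
  continuous_r : Continuous r
  continuous_w : Continuous w
  continuous_g : Continuous g
  r_nonneg : ∀ ω, 0 ≤ r ω
  re_pos : ∀ ω, 0 < c * r ω + (w ω).re
  integrable : Integrable (fun ω => ‖g ω‖ * (‖(c * r ω + w ω : ℂ)‖ ^ (n + 1))⁻¹) ν

/-- The symbol `∫ g ∏ⱼ (αⱼ r + w)⁻¹ dν`. -/
noncomputable def resolventSymbol {Ω : Type*} [MeasurableSpace Ω] (ν : Measure Ω) (r : Ω → ℝ)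
    (w g : Ω → ℂ) {n : ℕ} (α : Fin (n + 1) → ℝ) : ℂ :=
  ∫ ω, g ω * ∏ j, (α j * r ω + w ω : ℂ)⁻¹ ∂ν

section Scalar

variable {c r α : ℝ} {w : ℂ}

theorem denom_ne_zero (hr : 0 ≤ r) (h : 0 < c * r + w.re) (hα : c ≤ α) : (α * r + w : ℂ) ≠ 0 := by
  intro h0
  have h1 := congrArg Complex.re h0
  simp only [Complex.add_re, Complex.re_ofReal_mul, Complex.ofReal_re, Complex.zero_re] at h1
  have h2 := mul_le_mul_of_nonneg_right hα hr
  linarith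

theorem norm_denom_le (hr : 0 ≤ r) (h : 0 < c * r + w.re) (hα : c ≤ α) :
    ‖(c * r + w : ℂ)‖ ≤ ‖(α * r + w : ℂ)‖ := by
  refine le_of_sq_le_sq ?_ (norm_nonneg _)
  rw [← Complex.normSq_eq_norm_sq, ← Complex.normSq_eq_norm_sq, Complex.normSq_apply,
    Complex.normSq_apply]
  simp only [Complex.add_re, Complex.re_ofReal_mul, Complex.ofReal_re, Complex.add_im,
    Complex.im_ofReal_mul, Complex.ofReal_im, mul_zero, zero_add]
  have h2 := mul_le_mul_of_nonneg_right hα hr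
  have h3 := mul_self_le_mul_self h.le (by linarith : c * r + w.re ≤ α * r + w.re)
  linarith

theorem norm_denom_inv_le (hr : 0 ≤ r) (h : 0 < c * r + w.re) (hα : c ≤ α) :
    ‖(α * r + w : ℂ)⁻¹‖ ≤ ‖(c * r + w : ℂ)‖⁻¹ := by
  rw [norm_inv]
  exact inv_anti₀ (norm_pos_iff.2 (denom_ne_zero hr h le_rfl)) (norm_denom_le hr h hα)

end Scalar

namespace ResolventData

variable {Ω : Type*} [TopologicalSpace Ω] [MeasurableSpace Ω] {ν : Measure Ω} {n : ℕ} {c : ℝ}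
  {r : Ω → ℝ} {w g : Ω → ℂ}

theorem norm_integrand_le (h : ResolventData ν n c r w g) {α : Fin (n + 1) → ℝ}
    (hα : ∀ j, c ≤ α j) (ω : Ω) : ‖g ω * ∏ j, (α j * r ω + w ω : ℂ)⁻¹‖ ≤
      ‖g ω‖ * (‖(c * r ω + w ω : ℂ)‖ ^ (n + 1))⁻¹ := by
  rw [norm_mul, norm_prod]
  gcongr
  refine (Finset.prod_le_prod (fun _ _ => norm_nonneg _) fun j _ =>
    norm_denom_inv_le (h.r_nonneg ω) (h.re_pos ω) (hα j)).trans ?_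
  simp

theorem continuous_denom_inv (h : ResolventData ν n c r w g) {α : ℝ} (hα : c ≤ α) :
    Continuous fun ω => (α * r ω + w ω : ℂ)⁻¹ := by
  have h1 := h.continuous_r
  have h2 := h.continuous_w
  exact Continuous.inv₀ (by fun_prop) fun ω => denom_ne_zero (h.r_nonneg ω) (h.re_pos ω) hα

variable [OpensMeasurableSpace Ω]

theorem integrable_integrand (h : ResolventData ν n c r w g) {α : Fin (n + 1) → ℝ}
    (hα : ∀ j, c ≤ α j) : Integrable (fun ω => g ω * ∏ j, (α j * r ω + w ω : ℂ)⁻¹) ν :=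
  h.integrable.mono' (h.continuous_g.mul
    (continuous_finsetProd _ fun j _ => h.continuous_denom_inv (hα j))).aestronglyMeasurable
    (ae_of_all _ (h.norm_integrand_le hα))

/-- The strict inequality leaves a neighbourhood of `α` on which the integrand is dominated by its
bound at the corner `(c, …, c)`. -/
theorem continuousAt_symbol (h : ResolventData ν n c r w g) {α : Fin (n + 1) → ℝ}
    (hα : ∀ j, c < α j) : ContinuousAt (resolventSymbol (n := n) ν r w g) α := by
  have hev : ∀ᶠ β in 𝓝 α, ∀ j, c < β j := eventually_all.2 fun j =>
    (continuous_apply j).continuousAt.eventually (lt_mem_nhds (hα j))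
  refine continuousAt_of_dominated (bound := fun ω => ‖g ω‖ * (‖(c * r ω + w ω : ℂ)‖ ^ (n + 1))⁻¹)
    ?_ ?_ h.integrable (ae_of_all _ fun ω => ?_)
  · filter_upwards [hev] with β hβ
    exact (h.integrable_integrand fun j => (hβ j).le).aestronglyMeasurable
  · filter_upwards [hev] with β hβ
    exact ae_of_all _ (h.norm_integrand_le fun j => (hβ j).le)
  · refine ContinuousAt.mul continuousAt_const (tendsto_finsetProd _ fun j _ => ?_)
    have hj : ContinuousAt (fun β : Fin (n + 1) → ℝ => (β j : ℂ)) α :=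
      (Complex.continuous_ofReal.comp (continuous_apply j)).continuousAt
    refine ContinuousAt.inv₀ ((hj.mul continuousAt_const).add continuousAt_const)
      (denom_ne_zero (h.r_nonneg ω) (h.re_pos ω) (hα j).le)

end ResolventData

/-! ### Resolvents in the Borel calculus and their superpositions -/

section Operators

variable {H : Type*} [NormedAddCommGroup H] [InnerProductSpace ℂ H] [CompleteSpace H]

theorem IsBorelCalculus.const_smul {x : H →L[ℂ] H} {a : ℝ → ℂ} {G : H →L[ℂ] H}
    (h : IsBorelCalculus x a G) (k : ℂ) : IsBorelCalculus x (fun t => k * a t) (k • G) := by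
  intro u
  obtain ⟨μ, hμ, e⟩ := h u
  refine ⟨μ, hμ, ?_⟩
  rw [integral_const_mul, ← e, smul_apply, inner_smul_right]

section Single

variable {x : H →L[ℂ] H} {c r : ℝ} {w : ℂ}

theorem cfc_denom (hx : IsSelfAdjoint x) :
    cfc (fun z : ℂ => z * r + w) x = (r : ℂ) • x + w • (1 : H →L[ℂ] H) := by
  have hN : IsStarNormal x := hx.isStarNormal
  have h1 : (fun z : ℂ => z * r + w) = fun z => (r : ℂ) • z + w := by
    funext z
    rw [smul_eq_mul, mul_comm]
  rw [h1, cfc_add_const w (fun z : ℂ => (r : ℂ) • z) x (by fun_prop), cfc_smul_id (r : ℂ) x,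
    Algebra.algebraMap_eq_smul_one]

theorem cfc_denom_ne_zero (hx : IsSelfAdjoint x) (hc : ∀ t ∈ spectrum ℝ x, c ≤ t) (hr : 0 ≤ r)
    (h : 0 < c * r + w.re) :
    ∀ z ∈ spectrum ℂ x, z * r + w ≠ 0 := by
  intro z hz
  rw [hx.mem_spectrum_eq_re hz]
  refine denom_ne_zero hr h (hc _ ?_)
  rw [← spectrum.algebraMap_mem_iff ℂ]
  exact (hx.mem_spectrum_eq_re hz) ▸ hz

theorem isUnit_denom (hx : IsSelfAdjoint x) (hc : ∀ t ∈ spectrum ℝ x, c ≤ t) (hr : 0 ≤ r)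
    (h : 0 < c * r + w.re) :
    IsUnit ((r : ℂ) • x + w • (1 : H →L[ℂ] H)) := by
  have hN : IsStarNormal x := hx.isStarNormal
  rw [← cfc_denom hx]
  exact (isUnit_cfc_iff _ x (by fun_prop)).2 (cfc_denom_ne_zero hx hc hr h)

/-- Replacing `t` by `max t c` changes nothing on the spectrum and makes the function bounded on all
of `ℝ`, as a separation of variables demands. -/
theorem isBorelCalculus_inverse (hx : IsSelfAdjoint x) (hc : ∀ t ∈ spectrum ℝ x, c ≤ t) (hr : 0 ≤ r)
    (h : 0 < c * r + w.re) :
    IsBorelCalculus x (fun t => (max t c * r + w : ℂ)⁻¹)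
    (Ring.inverse ((r : ℂ) • x + w • (1 : H →L[ℂ] H))) := by
  have hN : IsStarNormal x := hx.isStarNormal
  rw [isBorelCalculus_iff hx]
  intro u
  rw [← cfc_denom hx, ← cfc_inv _ x (cfc_denom_ne_zero hx hc hr h) (by fun_prop),
    inner_cfc hx u (f := fun z => (z * r + w)⁻¹) (ContinuousOn.inv₀ (by fun_prop) (cfc_denom_ne_zero hx hc hr h))]
  refine integral_congr_ae ?_
  filter_upwards [ae_mem_spectrum hx u] with t ht
  rw [max_eq_left (hc t ht)]

theorem norm_inverse_le (hx : IsSelfAdjoint x) (hc : ∀ t ∈ spectrum ℝ x, c ≤ t) (hr : 0 ≤ r)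
    (h : 0 < c * r + w.re) :
    ‖Ring.inverse ((r : ℂ) • x + w • (1 : H →L[ℂ] H))‖ ≤
    4 * ‖(c * r + w : ℂ)‖⁻¹ := by
  refine (isBorelCalculus_inverse hx hc hr h).norm_le hx fun t => ?_
  exact_mod_cast norm_denom_inv_le hr h (le_max_right t c)

end Single

namespace ResolventData

variable {Ω : Type} [TopologicalSpace Ω] [MeasurableSpace Ω]
  {ν : Measure Ω} {n : ℕ} {c : ℝ} {r : Ω → ℝ} {w g : Ω → ℂ} {x : H →L[ℂ] H}

theorem continuous_inverse (h : ResolventData ν n c r w g) (hx : IsSelfAdjoint x)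
    (hc : ∀ t ∈ spectrum ℝ x, c ≤ t) :
    Continuous fun ω => Ring.inverse ((r ω : ℂ) • x + w ω • (1 : H →L[ℂ] H)) := by
  have h1 := h.continuous_r
  have h2 := h.continuous_w
  refine continuous_iff_continuousAt.2 fun ω => ?_
  obtain ⟨U, hU⟩ := isUnit_denom hx hc (h.r_nonneg ω) (h.re_pos ω)
  have h3 : ContinuousAt (Ring.inverse : (H →L[ℂ] H) → _)
      ((r ω : ℂ) • x + w ω • (1 : H →L[ℂ] H)) := hU ▸ NormedRing.inverse_continuousAt U
  exact ContinuousAt.comp (f := fun ω => (r ω : ℂ) • x + w ω • (1 : H →L[ℂ] H)) h3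
    (by fun_prop)

variable [OpensMeasurableSpace Ω] [SecondCountableTopology Ω]

theorem integrable_altProd (h : ResolventData ν n c r w g) (hx : IsSelfAdjoint x)
    (hc : ∀ t ∈ spectrum ℝ x, c ≤ t) (V : Fin n → (H →L[ℂ] H)) :
    Integrable (fun ω => g ω •
      altProd (fun _ => Ring.inverse ((r ω : ℂ) • x + w ω • (1 : H →L[ℂ] H))) V) ν := by
  refine (h.integrable.const_mul (4 ^ (n + 1) * ∏ i, ‖V i‖)).mono' ?_ (ae_of_all _ fun ω => ?_)
  · exact (h.continuous_g.smul
      (continuous_altProd (fun _ => h.continuous_inverse hx hc) V)).aestronglyMeasurable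
  · rw [norm_smul]
    refine (mul_le_mul_of_nonneg_left (norm_altProd_le _ _) (norm_nonneg _)).trans ?_
    have h1 : ∏ _j : Fin (n + 1), ‖Ring.inverse ((r ω : ℂ) • x + w ω • (1 : H →L[ℂ] H))‖ ≤
        4 ^ (n + 1) * (‖(c * r ω + w ω : ℂ)‖ ^ (n + 1))⁻¹ := by
      refine (Finset.prod_le_prod (fun _ _ => norm_nonneg _) fun j _ =>
        norm_inverse_le hx hc (h.r_nonneg ω) (h.re_pos ω)).trans ?_
      simp [mul_pow]
    refine (mul_le_mul_of_nonneg_left (mul_le_mul_of_nonneg_right h1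
      (Finset.prod_nonneg fun _ _ => norm_nonneg _)) (norm_nonneg _)).trans (le_of_eq ?_)
    ring

/-- A superposition of resolvent products is the multiple operator integral of its symbol. -/
theorem isMOI (h : ResolventData ν n c r w g) (hx : IsSelfAdjoint x)
    (hc : ∀ t ∈ spectrum ℝ x, c ≤ t) (V : Fin n → (H →L[ℂ] H)) {φ : (Fin (n + 1) → ℝ) → ℂ}
    (hφ : ∀ α : Fin (n + 1) → ℝ, (∀ j, α j ∈ spectrum ℝ x) →
      φ α = resolventSymbol ν r w g α) :
    IsMOI x φ V (∫ ω, g ω •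
      altProd (fun _ => Ring.inverse ((r ω : ℂ) • x + w ω • (1 : H →L[ℂ] H))) V ∂ν) := by
  let N : Ω → ℂ := fun ω => ‖(c * r ω + w ω : ℂ)‖
  -- The finite measure is `ρ ν`, with `ρ` the integrable bound. Each resolvent is multiplied by `‖c
  -- r + w‖` to have norm at most `1`, and the phase of `g` goes into the factor `j = 0`. Where `g =
  -- 0` the phase is `0 / 0 = 0`, harmless because `ρ` vanishes there.
  let ρ : Ω → NNReal := fun ω => ‖g ω‖₊ * (‖(c * r ω + w ω : ℂ)‖₊ ^ (n + 1))⁻¹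
  let K : Fin (n + 1) → Ω → ℂ := Fin.cons (fun ω => (g ω / ‖g ω‖) * N ω) fun _ => N
  have mr := h.continuous_r.measurable
  have mw := h.continuous_w.measurable
  have mg := h.continuous_g.measurable
  have hN : ∀ ω, N ω ≠ 0 := fun ω => Complex.ofReal_ne_zero.2
    (norm_ne_zero_iff.2 (denom_ne_zero (h.r_nonneg ω) (h.re_pos ω) le_rfl))
  have hρ : Measurable ρ := by fun_prop
  have hρe : ∀ ω, ((ρ ω : ℝ) : ℂ) = ‖g ω‖ * (N ω ^ (n + 1))⁻¹ := by
    intro ω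
    simp [ρ, N]
  have hKm : ∀ j, Measurable (K j) := by
    have hNm : Measurable N := by fun_prop
    intro j
    refine Fin.cases ?_ (fun _ => ?_) j
    · simp only [K, Fin.cons_zero]
      fun_prop
    · simpa only [K, Fin.cons_succ] using hNm
  have hKn : ∀ j ω, ‖K j ω‖ ≤ ‖(c * r ω + w ω : ℂ)‖ := by
    intro j ω
    refine Fin.cases ?_ (fun _ => ?_) j
    · simp only [K, Fin.cons_zero, norm_mul, norm_div, N, Complex.norm_real, norm_norm]
      exact mul_le_of_le_one_left (norm_nonneg _) (div_self_le_one _)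
    · simp [K, N]
  have hKp : ∀ ω, ((ρ ω : ℝ) : ℂ) * ∏ j, K j ω = g ω := by
    intro ω
    rw [hρe, Fin.prod_univ_succ]
    simp only [K, Fin.cons_zero, Fin.cons_succ, Finset.prod_const, Finset.card_univ,
      Fintype.card_fin]
    have h1 := hN ω
    rcases eq_or_ne (g ω) 0 with h0 | h0
    · simp [h0]
    · have h2 : (‖g ω‖ : ℂ) ≠ 0 := Complex.ofReal_ne_zero.2 (norm_ne_zero_iff.2 h0)
      field_simp
      ring
  have hfin : IsFiniteMeasure (ν.withDensity fun ω => (ρ ω : ENNReal)) := by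
    refine isFiniteMeasure_withDensity (ne_of_lt ?_)
    have h1 := h.integrable.2
    rw [HasFiniteIntegral] at h1
    refine lt_of_le_of_lt (lintegral_mono fun ω => ?_) h1
    rw [← ofReal_norm, ← ENNReal.ofReal_coe_nnreal]
    refine ENNReal.ofReal_le_ofReal (le_of_eq ?_)
    rw [Real.norm_of_nonneg (by positivity)]
    simp [ρ]
  have hvec : ∀ (u v : H) (ω : Ω), ρ ω • ⟪u, altProd (fun j => K j ω •
      Ring.inverse ((r ω : ℂ) • x + w ω • (1 : H →L[ℂ] H))) V v⟫_ℂ =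
      (innerSL ℂ u ∘L ContinuousLinearMap.apply ℂ H v) (g ω •
        altProd (fun _ => Ring.inverse ((r ω : ℂ) • x + w ω • (1 : H →L[ℂ] H))) V) := by
    intro u v ω
    rw [altProd_smul, ← hKp ω]
    simp [NNReal.smul_def]
    ring
  refine ⟨Ω, inferInstance, ν.withDensity fun ω => (ρ ω : ENNReal),
    fun j t ω => K j ω * (max t c * r ω + w ω : ℂ)⁻¹,
    fun j ω => K j ω • Ring.inverse ((r ω : ℂ) • x + w ω • (1 : H →L[ℂ] H)), hfin,
    fun j => ?_, ⟨1, fun j t ω => ?_⟩, fun α hα => ?_, fun j ω => ?_, fun u v => ⟨?_, ?_⟩⟩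
  · have := hKm j
    simp only [Function.uncurry_def]
    fun_prop
  · have h1 := norm_denom_inv_le (h.r_nonneg ω) (h.re_pos ω) (le_max_right t c)
    have h2 : 0 < ‖(c * r ω + w ω : ℂ)‖ :=
      norm_pos_iff.2 (denom_ne_zero (h.r_nonneg ω) (h.re_pos ω) le_rfl)
    rw [norm_mul]
    refine (mul_le_mul (hKn j ω) h1 (norm_nonneg _) h2.le).trans ?_
    rw [mul_inv_cancel₀ h2.ne']
  · rw [hφ α hα, integral_withDensity_eq_integral_smul hρ, resolventSymbol]
    refine integral_congr_ae (ae_of_all _ fun ω => ?_)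
    simp only [Finset.prod_mul_distrib, NNReal.smul_def, Complex.real_smul]
    rw [← mul_assoc, hKp ω]
    congr 1
    exact Finset.prod_congr rfl fun j _ => by rw [max_eq_left (hc _ (hα j))]
  · exact (isBorelCalculus_inverse hx hc (h.r_nonneg ω) (h.re_pos ω)).const_smul _
  · rw [integrable_withDensity_iff_integrable_smul hρ]
    simp only [hvec]
    exact ContinuousLinearMap.integrable_comp _ (h.integrable_altProd hx hc V)
  · rw [integral_withDensity_eq_integral_smul hρ]
    simp only [hvec]
    rw [ContinuousLinearMap.integral_comp_comm _ (h.integrable_altProd hx hc V)]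
    rfl

end ResolventData

end Operators

end MOI

/-! ### Divided differences as continuous extensions -/

namespace DivDiff

/-- For all small `ε ≠ 0` the points `α j + ε j` have distinct coordinates. -/
theorem mem_closure_injective {n : ℕ} (α : Fin (n + 1) → ℝ) :
    α ∈ closure {β : Fin (n + 1) → ℝ | Function.Injective β} := by
  have h1 : Tendsto (fun (ε : ℝ) (j : Fin (n + 1)) => α j + ε * (j : ℕ)) (𝓝[≠] 0) (𝓝 α) := by
    have h2 : Continuous fun (ε : ℝ) (j : Fin (n + 1)) => α j + ε * ((j : ℕ) : ℝ) := by fun_prop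
    have h3 := h2.tendsto 0
    simp only [zero_mul, add_zero] at h3
    exact h3.mono_left nhdsWithin_le_nhds
  refine mem_closure_of_tendsto h1 ?_
  have h2 : ∀ i j : Fin (n + 1), ∀ᶠ ε : ℝ in 𝓝[≠] 0,
      α i + ε * (i : ℕ) = α j + ε * (j : ℕ) → i = j := by
    intro i j
    by_cases hα : α i = α j
    · filter_upwards [self_mem_nhdsWithin] with ε hε h
      rw [hα, add_right_inj, mul_right_inj' hε, Nat.cast_inj] at h
      exact Fin.ext h
    · have h3 : ContinuousAt (fun ε : ℝ => α i + ε * (i : ℕ) - (α j + ε * (j : ℕ))) 0 := by fun_prop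
      have h4 := h3.eventually_ne (y := 0) (by simpa [sub_eq_zero] using hα)
      filter_upwards [h4.filter_mono nhdsWithin_le_nhds] with ε hε h
      exact absurd (sub_eq_zero.2 h) hε
  filter_upwards [eventually_all.2 fun i => eventually_all.2 (h2 i)] with ε hε i j hij
  exact hε i j hij

theorem eventually_injective_and_lt {n : ℕ} {c : ℝ} {α : Fin (n + 1) → ℝ} (hα : ∀ j, c < α j) :
    ∀ᶠ β in 𝓝[{β : Fin (n + 1) → ℝ | Function.Injective β}] α,
      Function.Injective β ∧ ∀ j, c < β j := by
  have h : ∀ᶠ β in 𝓝 α, ∀ j, c < β j := eventually_all.2 fun j =>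
    (continuous_apply j).continuousAt.eventually (lt_mem_nhds (hα j))
  filter_upwards [self_mem_nhdsWithin, h.filter_mono nhdsWithin_le_nhds] with β h1 h2
  exact ⟨h1, h2⟩

/-- A function continuous on `(c, ∞)ⁿ⁺¹` which is the difference quotient at points with distinct
coordinates is the divided difference. -/
theorem divDiff_eq {n : ℕ} {F : ℝ → ℂ} {c : ℝ} {K : (Fin (n + 1) → ℝ) → ℂ}
    (hK : ∀ α, Function.Injective α → (∀ j, c < α j) → quotient F n α = K α)
    {α : Fin (n + 1) → ℝ} (hα : ∀ j, c < α j) (hcont : ContinuousAt K α) : divDiff F n α = K α := by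
  refine extendFrom_eq (mem_closure_injective α) ?_
  refine (hcont.tendsto.mono_left nhdsWithin_le_nhds).congr' ?_
  filter_upwards [eventually_injective_and_lt hα] with β hβ
  exact (hK β hβ.1 hβ.2).symm

end DivDiff

namespace MOI

open DivDiff

theorem ResolventData.const_mul {Ω : Type*} [TopologicalSpace Ω] [MeasurableSpace Ω]
    {ν : Measure Ω} {n : ℕ} {c : ℝ} {r : Ω → ℝ} {w g : Ω → ℂ} (h : ResolventData ν n c r w g)
    (κ : ℂ) : ResolventData ν n c r w fun ω => κ * g ω where
  continuous_r := h.continuous_r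
  continuous_w := h.continuous_w
  continuous_g := continuous_const.mul h.continuous_g
  r_nonneg := h.r_nonneg
  re_pos := h.re_pos
  integrable := by
    simpa only [norm_mul, mul_assoc] using h.integrable.const_mul ‖κ‖

theorem resolventSymbol_const_mul {Ω : Type*} [MeasurableSpace Ω] (ν : Measure Ω) (r : Ω → ℝ)
    (w g : Ω → ℂ) {n : ℕ} (κ : ℂ) (α : Fin (n + 1) → ℝ) :
    resolventSymbol ν r w (fun ω => κ * g ω) α = κ * resolventSymbol ν r w g α := by
  simp only [resolventSymbol, mul_assoc, integral_const_mul]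

/-! ### Vertical lines -/

theorem resolventData_line {n : ℕ} (hn : 1 ≤ n) {c r δ : ℝ} (hr : 0 ≤ r) (h : 0 < c * r + δ) :
    ResolventData (volume : Measure ℝ) n c (fun _ => r) (fun t => δ + t * Complex.I)
      (fun t => Complex.exp (δ + t * Complex.I)) where
  continuous_r := continuous_const
  continuous_w := by fun_prop
  continuous_g := by fun_prop
  r_nonneg _ := hr
  re_pos t := by simpa using h
  integrable := by
    refine ((integrable_inv_norm_pow h hn).const_mul (Real.exp δ)).congr (ae_of_all _ fun t => ?_)
    simp only [Complex.norm_exp]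
    push_cast
    rw [add_assoc]
    simp

theorem resolventSymbol_line {n : ℕ} {r : ℝ} (hr : r ≠ 0) (δ : ℝ) (α : Fin (n + 1) → ℝ) :
    resolventSymbol volume (fun _ => r) (fun t : ℝ => δ + t * Complex.I)
      (fun t => Complex.exp (δ + t * Complex.I)) α = ((-r : ℂ) ^ n)⁻¹ * contour r δ α := by
  have h : (-r : ℂ) ^ n ≠ 0 := pow_ne_zero _ (neg_ne_zero.2 (Complex.ofReal_ne_zero.2 hr))
  rw [eq_inv_mul_iff_mul_eq₀ h, ← resolventSymbol_const_mul]
  rfl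

/-- The symbol does not depend on the vertical line. -/
theorem resolventSymbol_line_eq {n : ℕ} (hn : 1 ≤ n) {c r δ δ' : ℝ} (hr : 0 < r)
    (h : 0 < c * r + δ) (h' : 0 < c * r + δ') {α : Fin (n + 1) → ℝ} (hα : ∀ j, c < α j) :
    resolventSymbol volume (fun _ => r) (fun t : ℝ => δ + t * Complex.I)
      (fun t => Complex.exp (δ + t * Complex.I)) α =
    resolventSymbol volume (fun _ => r) (fun t : ℝ => δ' + t * Complex.I)
      (fun t => Complex.exp (δ' + t * Complex.I)) α := by
  have hbot := mem_closure_iff_nhdsWithin_neBot.1 (mem_closure_injective α)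
  -- Both symbols are continuous, and at distinct coordinates both equal the same multiple of a
  -- divided difference, which does not involve the abscissa.
  refine tendsto_nhds_unique (l := 𝓝[{β : Fin (n + 1) → ℝ | Function.Injective β}] α)
    (((resolventData_line hn hr.le h).continuousAt_symbol hα).tendsto.mono_left nhdsWithin_le_nhds)
    ((((resolventData_line hn hr.le h').continuousAt_symbol hα).tendsto.mono_left
      nhdsWithin_le_nhds).congr' ?_)
  filter_upwards [eventually_injective_and_lt hα] with β hβ
  have hlt : ∀ j, c * r ≤ β j * r := fun j => mul_le_mul_of_nonneg_right (hβ.2 j).le hr.le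
  rw [resolventSymbol_line hr.ne', resolventSymbol_line hr.ne',
    contour_eq_quotient hr hn hβ.1 fun j => by linarith [hlt j],
    contour_eq_quotient hr hn hβ.1 fun j => by linarith [hlt j]]

/-! ### Superposition over all lines -/

section Space

variable {E : Type} [NormedAddCommGroup E] [InnerProductSpace ℝ E] [FiniteDimensional ℝ E]
  [MeasurableSpace E] [BorelSpace E]

/-- The abscissa of the vertical line used at the vector `s`. -/
noncomputable def abscissa (c : ℝ) (s : E) : ℝ := 1 - c * ‖s‖ ^ 2 / 2

/-- On this line `c|s|² + w = c|s|²/2 + 1 + it`, of modulus at least `|1 + it|`, while `|e^w| = e ·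
e^{-c|s|²/2}`. The bound thus splits into a function of `s` times a function of `t`, both
integrable. -/
theorem resolventData_space {n : ℕ} (hn : 1 ≤ n) (p : ℕ) {c : ℝ} (hc : 0 < c) :
    ResolventData (volume : Measure (E × ℝ)) n c (fun q => ‖q.1‖ ^ 2)
      (fun q => abscissa c q.1 + q.2 * Complex.I)
      (fun q => ((-1) ^ n * (‖q.1‖ : ℂ) ^ p) *
        Complex.exp (abscissa c q.1 + q.2 * Complex.I)) where
  continuous_r := by fun_prop
  continuous_w := by
    unfold abscissa
    fun_prop
  continuous_g := by
    unfold abscissa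
    fun_prop
  r_nonneg _ := by positivity
  re_pos q := by
    have : 0 ≤ c * ‖q.1‖ ^ 2 := by positivity
    simp only [abscissa, Complex.add_re, Complex.ofReal_re, Complex.mul_re, Complex.I_re,
      Complex.ofReal_im, Complex.I_im]
    linarith
  integrable := by
    have hnz : ∀ q : E × ℝ, (c * (‖q.1‖ ^ 2 : ℝ) + (abscissa c q.1 + q.2 * Complex.I) : ℂ) =
        (1 : ℝ) * (c * ‖q.1‖ ^ 2 / 2 : ℝ) + (1 + q.2 * Complex.I) := by
      intro q
      simp only [abscissa]
      push_cast
      ring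
    have h0 : ∀ t : ℝ, (1 + t * Complex.I : ℂ) ≠ 0 := fun t => by
      simpa using ofReal_add_mul_I_ne_zero one_pos t
    have hle : ∀ q : E × ℝ, ‖(1 + q.2 * Complex.I : ℂ)‖ ≤
        ‖(c * (‖q.1‖ ^ 2 : ℝ) + (abscissa c q.1 + q.2 * Complex.I) : ℂ)‖ := by
      intro q
      have := norm_denom_le (c := 0) (α := 1) (r := c * ‖q.1‖ ^ 2 / 2)
        (w := 1 + q.2 * Complex.I) (by positivity) (by simp) zero_le_one
      rw [hnz q]
      simpa using this
    have hI := ((integrable_norm_pow_mul_exp (E := E) (half_pos hc) p).const_mul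
      (Real.exp 1)).mul_prod (integrable_inv_norm_pow one_pos hn)
    refine hI.mono' ?_ (ae_of_all _ fun q => ?_)
    · refine Continuous.aestronglyMeasurable (Continuous.mul ?_ (Continuous.inv₀ ?_ fun q => ?_))
      · unfold abscissa
        fun_prop
      · unfold abscissa
        fun_prop
      · exact pow_ne_zero _ ((norm_pos_iff.2 (h0 q.2)).trans_le (hle q)).ne'
    · rw [Real.norm_of_nonneg (by positivity)]
      have h1 : ‖((-1) ^ n * (‖q.1‖ : ℂ) ^ p) * Complex.exp (abscissa c q.1 + q.2 * Complex.I)‖ =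
          Real.exp 1 * (‖q.1‖ ^ p * Real.exp (-(‖q.1‖ ^ 2 * (c / 2)))) := by
        rw [norm_mul, Complex.norm_exp, mul_left_comm, ← Real.exp_add]
        have h2 : (abscissa c q.1 + q.2 * Complex.I : ℂ).re = 1 + -(‖q.1‖ ^ 2 * (c / 2)) := by
          rw [Complex.add_re, Complex.ofReal_re, Complex.re_ofReal_mul, Complex.I_re, abscissa]
          ring
        rw [h2]
        simp
      rw [h1]
      have h3 := norm_pos_iff.2 (h0 q.2)
      have h4 := hle q
      simp only [Complex.ofReal_one]
      gcongr

variable [Nontrivial E]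

/-- The symbol of the superposition over all lines is a divided difference. -/
theorem resolventSymbol_space {n m : ℕ} (hn : 1 ≤ n) (hmn : m ≤ n) {c : ℝ} (hc : 0 < c) {F : ℝ → ℂ}
    (hF : IsPrimitive (fun t : ℝ => ((t ^ (-(Module.finrank ℝ E : ℝ) / 2) : ℝ) : ℂ)) m F)
    {α : Fin (n + 1) → ℝ} (hα : Function.Injective α) (hcα : ∀ j, c < α j) :
    resolventSymbol (volume : Measure (E × ℝ)) (fun q => ‖q.1‖ ^ 2)
      (fun q => abscissa c q.1 + q.2 * Complex.I)
      (fun q => ((-1) ^ n * (‖q.1‖ : ℂ) ^ (2 * n - 2 * m)) *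
        Complex.exp (abscissa c q.1 + q.2 * Complex.I)) α =
      2 * Real.pi * ((-1) ^ m * (Real.pi ^ ((Module.finrank ℝ E : ℝ) / 2) : ℝ)) *
        quotient F n α := by
  have hint := (resolventData_space (E := E) hn (2 * n - 2 * m) hc).integrable_integrand
    fun j => (hcα j).le
  rw [resolventSymbol, Measure.volume_eq_prod, integral_prod _ hint]
  have h1 : ∀ᵐ s : E, ∫ t : ℝ, ((-1) ^ n * (‖s‖ : ℂ) ^ (2 * n - 2 * m)) *
      Complex.exp (abscissa c s + t * Complex.I) *
        ∏ j, (α j * (‖s‖ ^ 2 : ℝ) + (abscissa c s + t * Complex.I) : ℂ)⁻¹ =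
      (2 * Real.pi * (-1) ^ m) * (((-(‖s‖ ^ 2 : ℝ) : ℂ) ^ m)⁻¹ *
        quotient (fun t => Complex.exp (-(‖s‖ ^ 2 * t : ℝ))) n α) := by
    filter_upwards [Measure.ae_ne volume (0 : E)] with s hs
    have hs0 : (‖s‖ : ℂ) ≠ 0 := Complex.ofReal_ne_zero.2 (norm_ne_zero_iff.2 hs)
    have hr : 0 < ‖s‖ ^ 2 := by positivity
    have h2 := resolventSymbol_const_mul volume (fun _ => ‖s‖ ^ 2)
      (fun t : ℝ => abscissa c s + t * Complex.I)
      (fun t => Complex.exp (abscissa c s + t * Complex.I))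
      ((-1) ^ n * (‖s‖ : ℂ) ^ (2 * n - 2 * m)) α
    rw [resolventSymbol] at h2
    rw [h2, resolventSymbol_line hr.ne', contour_eq_quotient hr hn hα fun j => ?_]
    · have h3 : (‖s‖ : ℂ) ^ (2 * n) = (‖s‖ : ℂ) ^ (2 * n - 2 * m) * (‖s‖ : ℂ) ^ (2 * m) := by
        rw [← pow_add]
        congr 1
        omega
      have h4 : (-1 : ℂ) ^ m * (-1) ^ m = 1 := by
        rw [← mul_pow]
        simp
      have h5 : (-1 : ℂ) ^ n ≠ 0 := pow_ne_zero _ (by norm_num)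
      have h6 : (-1 : ℂ) ^ m ≠ 0 := pow_ne_zero _ (by norm_num)
      rw [neg_pow ((‖s‖ ^ 2 : ℝ) : ℂ) n, neg_pow ((‖s‖ ^ 2 : ℝ) : ℂ) m]
      push_cast
      rw [← pow_mul, ← pow_mul, h3]
      field_simp
    · have := mul_le_mul_of_nonneg_right (hcα j).le hr.le
      have := mul_pos hc hr
      rw [abscissa]
      linarith
  rw [integral_congr_ae h1, integral_const_mul, hF.integral_quotient_exp hmn hα fun j =>
    hc.trans (hcα j)]
  ring

theorem divDiff_eq_resolventSymbol {n m : ℕ} (hn : 1 ≤ n) (hmn : m ≤ n) {c : ℝ} (hc : 0 < c)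
    {F : ℝ → ℂ}
    (hF : IsPrimitive (fun t : ℝ => ((t ^ (-(Module.finrank ℝ E : ℝ) / 2) : ℝ) : ℂ)) m F)
    {α : Fin (n + 1) → ℝ} (hcα : ∀ j, c < α j) :
    divDiff F n α =
      (2 * Real.pi * ((-1) ^ m * (Real.pi ^ ((Module.finrank ℝ E : ℝ) / 2) : ℝ)) : ℂ)⁻¹ *
      resolventSymbol (volume : Measure (E × ℝ)) (fun q => ‖q.1‖ ^ 2)
        (fun q => abscissa c q.1 + q.2 * Complex.I)
        (fun q => ((-1) ^ n * (‖q.1‖ : ℂ) ^ (2 * n - 2 * m)) *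
          Complex.exp (abscissa c q.1 + q.2 * Complex.I)) α := by
  have hne : (2 * Real.pi * ((-1) ^ m * (Real.pi ^ ((Module.finrank ℝ E : ℝ) / 2) : ℝ)) : ℂ) ≠ 0 := by
    have h1 : ((Real.pi ^ ((Module.finrank ℝ E : ℝ) / 2) : ℝ) : ℂ) ≠ 0 :=
      Complex.ofReal_ne_zero.2 (by positivity)
    have h2 : (-1 : ℂ) ^ m ≠ 0 := pow_ne_zero _ (by norm_num)
    have h3 : (Real.pi : ℂ) ≠ 0 := Complex.ofReal_ne_zero.2 Real.pi_ne_zero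
    exact mul_ne_zero (mul_ne_zero two_ne_zero h3) (mul_ne_zero h2 h1)
  refine divDiff_eq (K := fun α => _ * resolventSymbol (volume : Measure (E × ℝ)) _ _ _ α)
    (fun β hβ hcβ => ?_) hcα (continuousAt_const.mul
      ((resolventData_space hn (2 * n - 2 * m) hc).continuousAt_symbol hcα))
  rw [resolventSymbol_space hn hmn hc hF hβ hcβ, inv_mul_cancel_left₀ hne]

end Space

/-- Half the least spectral value is used to get a strict inequality, which continuity of the
symbols at spectral points requires. -/
theorem exists_pos_lt_spectrum {H : Type*} [NormedAddCommGroup H] [InnerProductSpace ℂ H]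
    [CompleteSpace H] {x : H →L[ℂ] H} (hpos : x.IsPositive) (hunit : IsUnit x) :
    ∃ c : ℝ, 0 < c ∧ ∀ t ∈ spectrum ℝ x, c < t := by
  have h0 : ∀ t ∈ spectrum ℝ x, 0 < t := by
    intro t ht
    have h1 : 0 ≤ t := spectrum_nonneg_of_nonneg
      ((ContinuousLinearMap.nonneg_iff_isPositive x).2 hpos) ht
    refine lt_of_le_of_ne h1 fun h => ?_
    exact spectrum.zero_notMem ℝ hunit (h ▸ ht)
  rcases (spectrum ℝ x).eq_empty_or_nonempty with he | hne
  · exact ⟨1, one_pos, by simp [he]⟩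
  · obtain ⟨m, hm, hmin⟩ := (spectrum.isCompact x).exists_isLeast hne
    have := h0 m hm
    exact ⟨m / 2, half_pos this, fun t ht => (half_lt_self this).trans_le (hmin ht)⟩

end MOI

/-! ### The theorem on the noncommutative torus -/

namespace NCTorus

open MOI DivDiff

/-- The standard basis `(Uⁿ)` of `L₂(𝕋^d_θ)`. -/
noncomputable def stdBasis (d : ℕ) : HilbertBasis (Fin d → ℤ) ℂ (L2 d) :=
  HilbertBasis.ofRepr (LinearIsometryEquiv.refl ℂ (L2 d))

/-- As `m ≤ n`, the factors `|s|^{-2m}` and `|s|^{2n}` merge into a natural power, with no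
singularity at `0`; the zero abscissa is displayed to match the form of the vertical lines. -/
theorem integrand_eq {d n : ℕ} (x : L2 d →L[ℂ] L2 d) {m : ℕ} (hmn : m ≤ n)
    (b : Fin n → (L2 d →L[ℂ] L2 d)) {s : EuclideanSpace ℝ (Fin d)} (hs : s ≠ 0) (t : ℝ) :
    integrand x (2 * m) b s t =
      (((-1) ^ n * (‖s‖ : ℂ) ^ (2 * n - 2 * m)) * Complex.exp ((0 : ℝ) + t * Complex.I)) •
        altProd (fun _ => Ring.inverse (((‖s‖ ^ 2 : ℝ) : ℂ) • x +
          ((0 : ℝ) + t * Complex.I : ℂ) • (1 : L2 d →L[ℂ] L2 d))) b := by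
  have hs0 : (‖s‖ : ℂ) ≠ 0 := Complex.ofReal_ne_zero.2 (norm_ne_zero_iff.2 hs)
  have h3 : (‖s‖ : ℂ) ^ (2 * n) = (‖s‖ : ℂ) ^ (2 * n - 2 * m) * (‖s‖ : ℂ) ^ (2 * m) := by
    rw [← pow_add]
    congr 1
    omega
  rw [integrand, S, smul_smul, h3, Complex.ofReal_zero, zero_add, Complex.ofReal_pow]
  congr 1
  field_simp

end NCTorus

open MOI DivDiff NCTorus in
theorem theorem6p1 (d : ℕ) (hd : 2 ≤ d) (θ : Matrix (Fin d) (Fin d) ℝ) (hθ : θ.transpose = -θ)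
    (x : NCTorus.L2 d →L[ℂ] NCTorus.L2 d) (hx : x ∈ NCTorus.Smooth θ)
    (hpos : x.IsPositive) (hunit : IsUnit x)
    (n : ℕ) (hn : 1 ≤ n) (b : Fin n → (NCTorus.L2 d →L[ℂ] NCTorus.L2 d))
    (hb : ∀ i, b i ∈ NCTorus.Smooth θ)
    (k : ℕ) (hk : Even k) (hkn : k ≤ 2 * n)
    (F : ℝ → ℂ)
    (hF : DivDiff.IsPrimitive (fun t : ℝ => ((t ^ (-(d : ℝ) / 2) : ℝ) : ℂ)) (k / 2) F) :
    (∃! T, MOI.IsMOI x (DivDiff.divDiff F n) b T) ∧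
    ∃ J : EuclideanSpace ℝ (Fin d) → (NCTorus.L2 d →L[ℂ] NCTorus.L2 d),
      (∀ s, s ≠ 0 →
        Integrable (fun lam : ℝ => NCTorus.integrand x k b s lam) ∧
        Tendsto (fun N : ℝ => ∫ lam in (-N)..N, NCTorus.integrand x k b s lam) atTop (𝓝 (J s))) ∧
      Integrable J ∧
      ((2 * Real.pi : ℝ)⁻¹ : ℂ) • ∫ s, J s =
        ((-1 : ℂ) ^ (k / 2) * ((Real.pi ^ ((d : ℝ) / 2) : ℝ) : ℂ)) •
          MOI.moi x (DivDiff.divDiff F n) b := by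
  have hsa : IsSelfAdjoint x := hpos.isSelfAdjoint
  obtain ⟨c, hc, hsp⟩ := exists_pos_lt_spectrum hpos hunit
  have hsp' : ∀ t ∈ spectrum ℝ x, c ≤ t := fun t ht => (hsp t ht).le
  obtain ⟨m, rfl⟩ := hk
  rw [← two_mul] at hkn
  simp only [← two_mul, Nat.mul_div_cancel_left _ (two_pos : 0 < 2)] at hF ⊢
  have hmn : m ≤ n := by omega
  -- This makes the Euclidean space nontrivial, so that its origin is a null set.
  have hne : Nonempty (Fin d) := ⟨⟨0, by omega⟩⟩
  have hfr : (Module.finrank ℝ (EuclideanSpace ℝ (Fin d)) : ℝ) = d := by simp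
  have hR := resolventData_space (E := EuclideanSpace ℝ (Fin d)) hn (2 * n - 2 * m) hc
  rw [← hfr] at hF ⊢
  set κ : ℂ := (2 * Real.pi * ((-1) ^ m *
    (Real.pi ^ ((Module.finrank ℝ (EuclideanSpace ℝ (Fin d)) : ℝ) / 2) : ℝ)) : ℂ)⁻¹ with hκ
  -- The integrand on the shifted lines, jointly integrable in `(s, t)`; its `t`-integral serves as
  -- `J s`.
  let G : EuclideanSpace ℝ (Fin d) × ℝ → (L2 d →L[ℂ] L2 d) := fun q =>
    (((-1) ^ n * (‖q.1‖ : ℂ) ^ (2 * n - 2 * m)) *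
      Complex.exp (abscissa c q.1 + q.2 * Complex.I)) •
      altProd (fun _ => Ring.inverse (((‖q.1‖ ^ 2 : ℝ) : ℂ) • x +
        (abscissa c q.1 + q.2 * Complex.I : ℂ) • (1 : L2 d →L[ℂ] L2 d))) b
  have hG : Integrable G := hR.integrable_altProd hsa hsp' b
  have hmoi : IsMOI x (divDiff F n) b (κ • ∫ q, G q) := by
    have h := (hR.const_mul κ).isMOI hsa hsp' b (φ := divDiff F n) fun α hα => by
      rw [divDiff_eq_resolventSymbol hn hmn hc hF fun j => hsp _ (hα j), resolventSymbol_const_mul]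
    rw [← integral_smul]
    simp only [G, smul_smul]
    exact h
  refine ⟨⟨_, hmoi, fun T hT => hT.unique (stdBasis d) hsa (fun _ _ => rfl) hmoi⟩,
    fun s => ∫ t, G (s, t), fun s hs => ?_, hG.integral_prod_left, ?_⟩
  · have hr : 0 < ‖s‖ ^ 2 := by positivity
    have h0 : 0 < c * ‖s‖ ^ 2 + 0 := by positivity
    have h1 : 0 < c * ‖s‖ ^ 2 + abscissa c s := by
      rw [abscissa]
      linarith [mul_pos hc hr]
    have d0 := (resolventData_line hn hr.le h0).const_mul
      ((-1) ^ n * (‖s‖ : ℂ) ^ (2 * n - 2 * m))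
    have d1 := (resolventData_line hn hr.le h1).const_mul
      ((-1) ^ n * (‖s‖ : ℂ) ^ (2 * n - 2 * m))
    simp only [integrand_eq x hmn b hs]
    have hint := d0.integrable_altProd hsa hsp' b
    refine ⟨hint, ?_⟩
    -- The shifted line and the imaginary axis give multiple operator integrals whose symbols agree
    -- on the spectrum, so the operators coincide.
    have heq := (d1.isMOI hsa hsp' b fun _ _ => rfl).unique (stdBasis d) hsa (fun α hα => ?_)
      (d0.isMOI hsa hsp' b fun _ _ => rfl)
    · have hJ : ∫ t, G (s, t) = _ := heq
      rw [hJ]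
      exact intervalIntegral_tendsto_integral hint tendsto_neg_atTop_atBot tendsto_id
    · rw [resolventSymbol_const_mul, resolventSymbol_const_mul,
        resolventSymbol_line_eq hn hr h1 h0 fun j => hsp _ (hα j)]
  · rw [hmoi.moi_eq (stdBasis d) hsa, Measure.volume_eq_prod, integral_prod _ hG, smul_smul]
    congr 1
    have h1 : ((Real.pi ^ ((Module.finrank ℝ (EuclideanSpace ℝ (Fin d)) : ℝ) / 2) : ℝ) : ℂ) ≠ 0 :=
      Complex.ofReal_ne_zero.2 (by positivity)
    have h2 : (-1 : ℂ) ^ m ≠ 0 := pow_ne_zero _ (by norm_num)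
    rw [hκ, mul_inv, ← mul_assoc, mul_comm _ (2 * (Real.pi : ℂ))⁻¹, mul_assoc,
      mul_inv_cancel₀ (mul_ne_zero h2 h1), mul_one]
    push_cast
    rfl
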